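/- Let $\mathsf V$ be a countable set, $(S,\mathcal S)$ a standard Borel space, $\chi$ a probability measure on it, $\Sigma=S^{\mathsf V}$ with the product $\sigma$-algebra $\mathcal F$, and for $\Delta\subset\mathsf V$ let $\mathcal F_\Delta$ be the $\sigma$-algebra generated by $\sigma_\Delta=(\sigma_x)_{x\in\Delta}$. Let $\mathsf H=(\mathsf V,\mathsf E)$ be a hypergraph: $\mathsf E$ is an infinite collection of finite subsets $e\subset\mathsf V$ with $|e|\ge 2$, and each $x\in\mathsf V$ lies in finitely many $e\in\mathsf E$. Let $\mathsf L(\mathsf H)$ be its line-graph, with vertex set $\mathsf E$ and distinct $e,e'$ adjacent iff $e\cap e'\ne\varnothing$; let $n_{\mathsf L}(e)$ be the degree of $e$ in it. For an integer $r\ge 1$ let $\mathcal A_r(e)$ be the family of finite connected vertex sets $A$ of $\mathsf L(\mathsf H)$ that contain $e$, lie in the ball of radius $r$ about $e$ (in the graph distance of $\mathsf L(\mathsf H)$), and have $|A|\ge r+1$. Assume that $\mathsf L(\mathsf H)$ is $(g,\bar a)$-tempered for some $\bar a>0$ and some strictly increasing $g:\{1,2,\dots\}\to[0,\infty)$ with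 $g(n)\ge\log n$ for all $n\ge1$; that is, for each $e\in\mathsf E$ there is a strictly increasing sequence $(N_k)_{k\in\mathbb N}=(N_k(e))_{k\in\mathbb N}$ of positive integers such that $$\sup_{e\in\mathsf E}\ \sup_{k\in\mathbb N}\ \max_{A\in\mathcal A_{N_k}(e)}\ \frac1{|A|}\sum_{e'\in A}g(n_{\mathsf L}(e'))=\bar a .$$ On a probability space $(\Omega,\mathbb P)$ let $\varphi_e:S^e\to\mathbb R$, $e\in\mathsf E$, be random functions, measurable on $S^e$ for each realization, with random finite bounds $a_e\le\varphi_e\le b_e$, such that the $c_e:=b_e-a_e$, $e\in\mathsf E$, are independent and identically distributed random variables with $\mathbb E\,e^{Kc_e}<\infty$ for all $K>0$ and all $e\in\mathsf E$. For $K>0$ put $h_e(\sigma)=\exp(K\varphi_e(\sigma_e))$, for each nonempty finite $\Lambda\subset\mathsf V$ let $h_\Lambda=\prod_{e\in\mathsf E:\,e\cap\Lambda\ne\varnothing}h_e$, let $\chi_\Lambda(\cdot|\sigma)$ be the product of $\chi^{\Lambda}$ and the Dirac measure at $\sigma_{\Lambda^c}$, and let $\gamma_\Lambda(d\eta|\sigma)=\frac{h_\Lambda(\eta)}{\int_\Sigma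 h_\Lambda\,d\chi_\Lambda(\cdot|\sigma)}\,\chi_\Lambda(d\eta|\sigma)$. Let $\mathcal G(\gamma)$ be the (random) set of probability measures $\mu$ on $(\Sigma,\mathcal F)$ with $\mu(A|\mathcal F_{\Lambda^c})=\gamma_\Lambda(A|\cdot)$ $\mu$-almost surely for all $A\in\mathcal F$ and all nonempty finite $\Lambda\subset\mathsf V$. Then there is $K_*>0$ such that, for every $K\in(0,K_*)$, almost surely $\mathcal G(\gamma)$ is a singleton $\{\mu\}$ and $\mu$ is globally Markov: for every $\Delta\subset\mathsf V$ (finite or infinite) and every $A\in\mathcal F_\Delta$, $$\mu(A|\mathcal F_{\Delta^c})=\mu(A|\mathcal F_{\partial\Delta})\quad\mu\text{-almost surely},\qquad \partial\Delta=\{y\in\Delta^c:\ \exists x\in\Delta\ \exists e\in\mathsf E\ \ \{x,y\}\subset e\}.$$ -/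

import Mathlib

open MeasureTheory ProbabilityTheory
open scoped ENNReal

namespace MarkovField

/-! ### Tempered graphs -/

/-- The degree `n_G x` of a vertex (meaningful where the graph is locally finite). -/
noncomputable def deg {W : Type*} (G : SimpleGraph W) (x : W) : ℕ :=
  (G.neighborSet x).ncard

/-- The family of animals `A` (finite nonempty vertex sets generating a connected subgraph) with
`x ∈ A`, contained in the ball of radius `r` around `x`, and having at least `r + 1` vertices. -/
def animals {W : Type*} (G : SimpleGraph W) (r : ℕ) (x : W) : Set (Finset W) :=
  {A | x ∈ A ∧ (∀ y ∈ A, G.edist x y ≤ (r : ℕ∞)) ∧ r + 1 ≤ A.card ∧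
    (G.induce (A : Set W)).Connected}

/-- The average of `g (n_G y)` over the vertices `y` of a finite set `A`. -/
noncomputable def degAverage {W : Type*} (G : SimpleGraph W) (g : ℕ → ℝ) (A : Finset W) : ℝ :=
  (A.card : ℝ)⁻¹ * ∑ y ∈ A, g (deg G y)

/-- `(g, a)`-temperedness: for each vertex `x` there is a strictly increasing sequence of positive
integers `N x k` such that the supremum of the degree averages over all `x`, all `k` and all animals
in `animals G (N x k) x` is `a`. The (non-negative) averages are compared in `[0, ∞]`, so the
supremum is the true one, and an empty family of animals contributes nothing. -/
def IsTempered {W : Type*} (G : SimpleGraph W) (g : ℕ → ℝ) (a : ℝ) : Prop :=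
  ∃ N : W → ℕ → ℕ, (∀ x, StrictMono (N x)) ∧ (∀ x k, 0 < N x k) ∧
    ⨆ x, ⨆ k, ⨆ A ∈ animals G (N x k) x, ENNReal.ofReal (degAverage G g A) = ENNReal.ofReal a

/-! ### The dependence hypergraph and its line-graph -/

/-- A locally finite hypergraph on the vertex set `V`: an infinite collection of finite subsets of
`V`, none of which is empty or a singleton, such that each vertex lies in finitely many of them. -/
structure DependenceHypergraph (V : Type*) where
  edges : Set (Finset V)
  infinite : edges.Infinite
  two_le_card : ∀ e ∈ edges, 2 ≤ e.card
  locallyFinite : ∀ x : V, {e ∈ edges | x ∈ e}.Finite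

namespace DependenceHypergraph

variable {V : Type*} (H : DependenceHypergraph V)

/-- The line-graph: its vertices are the hyperedges, two distinct hyperedges being adjacent when
they intersect. -/
def lineGraph : SimpleGraph H.edges where
  Adj e e' := e ≠ e' ∧ ∃ x : V, x ∈ (e : Finset V) ∧ x ∈ (e' : Finset V)
  symm := ⟨fun _ _ h => ⟨h.1.symm, h.2.imp fun _ hx => ⟨hx.2, hx.1⟩⟩⟩
  loopless := ⟨fun _ h => h.1 rfl⟩

/-- The hyperedges which meet `Λ`. -/
def edgesMeeting (Λ : Finset V) : Set H.edges :=
  {e | ∃ x ∈ Λ, x ∈ (e : Finset V)}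

theorem finite_edgesMeeting (Λ : Finset V) : (H.edgesMeeting Λ).Finite := by
  have h : (⋃ x ∈ Λ, {e ∈ H.edges | x ∈ e}).Finite :=
    Λ.finite_toSet.biUnion fun x _ => H.locallyFinite x
  refine Set.Finite.of_finite_image (f := Subtype.val) (h.subset ?_) Subtype.val_injective.injOn
  rintro _ ⟨e, ⟨x, hx, hxe⟩, rfl⟩
  exact Set.mem_biUnion (Finset.mem_coe.2 hx) ⟨e.2, hxe⟩

/-- The line-graph is locally finite, so that its degrees are genuine. -/
theorem finite_neighborSet_lineGraph (e : H.edges) : (H.lineGraph.neighborSet e).Finite :=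
  (H.finite_edgesMeeting e).subset fun _ h => h.2

/-- The boundary of `Δ`: the vertices outside `Δ` sharing a hyperedge with some vertex of `Δ`. -/
def boundary (Δ : Set V) : Set V :=
  {y | y ∉ Δ ∧ ∃ x ∈ Δ, ∃ e ∈ H.edges, x ∈ e ∧ y ∈ e}

end DependenceHypergraph

/-! ### The specification and its random fields -/

section Specification

variable {V S : Type*} [MeasurableSpace S] (H : DependenceHypergraph V)

open Classical in
/-- The configuration equal to `ξ` on `Λ` and to `σ` off `Λ`. -/
noncomputable def glue (Λ : Finset V) (ξ : Λ → S) (σ : V → S) : V → S :=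
  fun x => if hx : x ∈ Λ then ξ ⟨x, hx⟩ else σ x

/-- The kernel `χ_Λ(· | σ)`: the product of `χ` over `Λ`, times the Dirac mass at `σ` off `Λ`. -/
noncomputable def indepKernel (χ : Measure S) (Λ : Finset V) (σ : V → S) : Measure (V → S) :=
  (Measure.pi fun _ : Λ => χ).map fun ξ => glue Λ ξ σ

/-- `h_Λ(σ)`, the product of `h_e(σ_e)` over the hyperedges `e` that meet `Λ`. -/
noncomputable def preMod (h : ∀ e : H.edges, (↥e.1 → S) → ℝ) (Λ : Finset V)
    (σ : V → S) : ℝ :=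
  ∏ e ∈ (H.finite_edgesMeeting Λ).toFinset, h e (e.1.restrict σ)

/-- The specification `γ_Λ(· | σ)`: the measure `χ_Λ(· | σ)` with density `h_Λ / χ_Λ(h_Λ)(σ)`. -/
noncomputable def spec (χ : Measure S) (h : ∀ e : H.edges, (↥e.1 → S) → ℝ)
    (Λ : Finset V) (σ : V → S) : Measure (V → S) :=
  (∫⁻ η, ENNReal.ofReal (preMod H h Λ η) ∂(indepKernel χ Λ σ))⁻¹ •
    (indepKernel χ Λ σ).withDensity fun η => ENNReal.ofReal (preMod H h Λ η)

/-- The set `𝒢(γ)` of random fields specified by `γ`: the probability measures `μ` on `V → S` with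
`μ(A | F_{Λᶜ}) = γ_Λ(A | ·)` `μ`-almost surely, for all measurable `A` and finite nonempty `Λ`. -/
def fields (χ : Measure S) (h : ∀ e : H.edges, (↥e.1 → S) → ℝ) :
    Set (Measure (V → S)) :=
  {μ | IsProbabilityMeasure μ ∧ ∀ Λ : Finset V, Λ.Nonempty → ∀ A : Set (V → S), MeasurableSet A →
    μ⟦A | cylinderEvents (X := fun _ : V => S) ((Λ : Set V)ᶜ)⟧ =ᵐ[μ]
      fun σ => (spec H χ h Λ σ).real A}

/-- The global Markov property: for every `Δ ⊆ V`, finite or infinite, the conditional probability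
of an event in `Δ` given the configuration off `Δ` depends only on the configuration on the
boundary of `Δ`. -/
def IsGloballyMarkov (μ : Measure (V → S)) : Prop :=
  ∀ Δ : Set V, ∀ A : Set (V → S), MeasurableSet[cylinderEvents (X := fun _ : V => S) Δ] A →
    μ⟦A | cylinderEvents (X := fun _ : V => S) Δᶜ⟧ =ᵐ[μ]
      μ⟦A | cylinderEvents (X := fun _ : V => S) (H.boundary Δ)⟧

end Specification

end MarkovField

set_option linter.unusedVariables false
set_option linter.unusedSectionVars false

/-! The proof is disagreement percolation on the line-graph. Take two independent configurations in
`Λ` with boundary conditions `σ` and `σ'`, and split the joint weight of each hyperedge into the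
constant `m e ^ 2` and a nonnegative remainder, which is at most `p e = 1 - exp (-2 K c_e)` times
that weight. Expanding the product declares each hyperedge open (remainder) or closed (constant). If
the open clusters started at `I` stay where the boundary conditions agree, exchanging the two
configurations on these clusters preserves the measure and trades one probability of a local event
for the other. Hence the two probabilities differ by at most the sum, over self-avoiding paths of
prescribed lengths from `I`, of the products of the `p e` (`HasBounds.spec_apply_le`).

The vertices of a self-avoiding path with `n` steps form an animal, so for `n = N_k(e)` temperedness
and `log ≤ g` bound the product of their degrees by `exp (a (n + 1))`. As simple random walk gives
these paths total mass at most one, this also bounds their number (`card_saws_le`). By independence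
the expected path sum is at most `(exp a * q) ^ (n + 1)`, where `q` bounds the mean of `p e` and is
of order `K`. For small `K` this is summable in `k`, so almost surely the path sums tend to zero for
all hyperedges at once (`ae_tendsto_sawSum`).

The rest is deterministic and rests on `HasSmallInfluence`, whose uniformity in `Λ` is essential.
Sets `Λ ⊇ D` give uniqueness (`eq_of_mem_fields`) and a Cauchy net of finite-volume measures, hence
existence (`exists_mem_fields`). For the global Markov property (`condExp_boundary_of_mem_fields`)
take `Λ = D ∩ Δ`: the kernel hardly feels the spins in `Δ \ Λ`, and once these are frozen it reads
only the boundary of `Δ`. -/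

namespace MarkovField

/-! ### Self-avoiding paths -/

section Saw

variable {W : Type*} {G : SimpleGraph W} (hG : ∀ x, (G.neighborSet x).Finite)

open Classical in
/-- The self-avoiding paths with `n` steps from `x`, as pairs of the endpoint and the list of the
previous vertices, in reverse order. -/
noncomputable def saws (x : W) : ℕ → Finset (W × List W)
  | 0 => {(x, [])}
  | n + 1 => (saws x n).biUnion fun p =>
      ((hG p.1).toFinset.filter fun z => z ∉ p.1 :: p.2).image fun z => (z, p.1 :: p.2)

theorem mem_saws_zero {x : W} {p : W × List W} : p ∈ saws hG x 0 ↔ p = (x, []) := by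
  simp [saws]

theorem mem_saws_succ {x : W} {n : ℕ} {q : W × List W} :
    q ∈ saws hG x (n + 1) ↔
      ∃ p ∈ saws hG x n, G.Adj p.1 q.1 ∧ q.1 ∉ p.1 :: p.2 ∧ q.2 = p.1 :: p.2 := by
  classical
  simp only [saws, Finset.mem_biUnion, Finset.mem_image, Finset.mem_filter, Set.Finite.mem_toFinset,
    SimpleGraph.mem_neighborSet]
  constructor
  · rintro ⟨p, hp, z, ⟨h1, h2⟩, rfl⟩
    exact ⟨p, hp, h1, h2, rfl⟩
  · rintro ⟨p, hp, h1, h2, h3⟩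
    exact ⟨p, hp, q.1, ⟨h1, h2⟩, by rw [← h3]⟩

theorem nodup_of_mem_saws {x : W} {n : ℕ} {p : W × List W} (hp : p ∈ saws hG x n) :
    (p.1 :: p.2).Nodup := by
  induction n generalizing p with
  | zero => rw [mem_saws_zero] at hp; simp [hp]
  | succ n ih =>
    obtain ⟨q, hq, -, h2, h3⟩ := (mem_saws_succ hG).1 hp
    rw [h3]
    exact List.nodup_cons.2 ⟨h2, ih hq⟩

theorem length_of_mem_saws {x : W} {n : ℕ} {p : W × List W} (hp : p ∈ saws hG x n) :
    p.2.length = n := by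
  induction n generalizing p with
  | zero => rw [mem_saws_zero] at hp; simp [hp]
  | succ n ih =>
    obtain ⟨q, hq, -, h2, h3⟩ := (mem_saws_succ hG).1 hp
    rw [h3, List.length_cons, ih hq]

theorem one_le_deg_of_adj {x y : W} (hG : ∀ x, (G.neighborSet x).Finite) (h : G.Adj x y) :
    1 ≤ deg G x :=
  (Set.ncard_pos (hG x)).2 ⟨y, h⟩

/-- Degree zero must be excluded, since `log ≤ g` starts at 1 and the inverse degrees have to
cancel. A path without steps may sit at an isolated vertex, hence `n ≠ 0`. -/
theorem one_le_deg_of_mem_saws {x : W} {n : ℕ} {p : W × List W} (hp : p ∈ saws hG x n)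
    (hn : n ≠ 0) : ∀ u ∈ p.1 :: p.2, 1 ≤ deg G u := by
  induction n generalizing p with
  | zero => exact absurd rfl hn
  | succ n ih =>
    obtain ⟨q, hq, h1, h2, h3⟩ := (mem_saws_succ hG).1 hp
    have hq1 : 1 ≤ deg G q.1 := one_le_deg_of_adj hG h1
    have hp1 : 1 ≤ deg G p.1 := one_le_deg_of_adj hG h1.symm
    rw [h3]
    rcases Nat.eq_zero_or_pos n with rfl | hn'
    · rw [mem_saws_zero] at hq
      subst hq
      simpa using ⟨hp1, hq1⟩
    · intro u hu
      rcases List.mem_cons.1 hu with rfl | hu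
      · exact hp1
      · exact ih hq hn'.ne' u hu

-- This is how temperedness reaches paths: self-avoidance makes the `n + 1` vertices distinct, and a
-- path is connected and stays within distance `n` of its start.
open Classical in
theorem toFinset_mem_animals {x : W} {n : ℕ} {p : W × List W} (hp : p ∈ saws hG x n) :
    (p.1 :: p.2).toFinset ∈ animals G n x := by
  refine ⟨?_, ?_, ?_, ?_⟩
  · induction n generalizing p with
    | zero => rw [mem_saws_zero] at hp; simp [hp]
    | succ n ih =>
      obtain ⟨q, hq, h1, h2, h3⟩ := (mem_saws_succ hG).1 hp
      have := ih hq
      rw [h3]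
      simp only [List.mem_toFinset] at this ⊢
      exact List.mem_cons_of_mem _ this
  · simp only [List.mem_toFinset]
    induction n generalizing p with
    | zero => rw [mem_saws_zero] at hp; simp [hp]
    | succ n ih =>
      obtain ⟨q, hq, h1, h2, h3⟩ := (mem_saws_succ hG).1 hp
      have h := ih hq
      intro y hy
      rw [h3] at hy
      rcases List.mem_cons.1 hy with rfl | hy
      · have h4 : G.edist q.1 p.1 ≤ 1 := by
          simpa using SimpleGraph.edist_le h1.toWalk
        calc G.edist x p.1 ≤ G.edist x q.1 + G.edist q.1 p.1 := SimpleGraph.edist_triangle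
          _ ≤ n + 1 := add_le_add (h _ List.mem_cons_self) h4
          _ = ((n + 1 : ℕ) : ℕ∞) := by push_cast; rfl
      · exact (h y hy).trans (by exact_mod_cast n.le_succ)
  · rw [List.toFinset_card_of_nodup (nodup_of_mem_saws hG hp), List.length_cons,
      length_of_mem_saws hG hp]
  · induction n generalizing p with
    | zero =>
      rw [mem_saws_zero] at hp
      have h : (((p.1 :: p.2).toFinset : Finset W) : Set W) = {x} := by simp [hp]
      rw [h]
      exact ⟨SimpleGraph.Preconnected.of_subsingleton⟩
    | succ n ih =>
      obtain ⟨q, hq, h1, h2, h3⟩ := (mem_saws_succ hG).1 hp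
      have h := SimpleGraph.induce_union_connected (ih hq).preconnected
        (SimpleGraph.induce_pair_connected_of_adj h1).preconnected
        ⟨q.1, by simp, by simp⟩
      have h4 : (((p.1 :: p.2).toFinset : Finset W) : Set W) =
          (((q.1 :: q.2).toFinset : Finset W) : Set W) ∪ {q.1, p.1} := by
        ext u
        simp only [h3, Finset.mem_coe, List.mem_toFinset, List.mem_cons, Set.mem_union,
          Set.mem_insert_iff, Set.mem_singleton_iff]
        tauto
      rw [h4]
      exact h

/-- The random walk assigns total weight at most one to the self-avoiding paths. -/
theorem sum_saws_prod_inv_deg_le (x : W) (n : ℕ) :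
    ∑ p ∈ saws hG x n, (p.2.map fun u => (deg G u : ℝ)⁻¹).prod ≤ 1 := by
  classical
  induction n with
  | zero => simp [saws]
  | succ n ih =>
    refine le_trans ?_ ih
    have hnn : ∀ l : List W, 0 ≤ (l.map fun u => (deg G u : ℝ)⁻¹).prod := fun l =>
      List.prod_nonneg (by simp only [List.mem_map]; rintro _ ⟨u, -, rfl⟩; positivity)
    rw [saws, Finset.sum_biUnion]
    -- A path has at most `deg p.1` one-step extensions, and each gains the factor `(deg p.1)⁻¹`.
    -- For an isolated endpoint the inverse is 0, which keeps the bound by 1.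
    · refine Finset.sum_le_sum fun p _ => ?_
      rw [Finset.sum_image (by intro a _ b _ h; exact (Prod.ext_iff.1 h).1)]
      simp only [List.map_cons, List.prod_cons, Finset.sum_const, nsmul_eq_mul]
      rw [← mul_assoc]
      refine mul_le_of_le_one_left (hnn _) ?_
      calc _ ≤ (deg G p.1 : ℝ) * (deg G p.1 : ℝ)⁻¹ := by
            gcongr
            rw [deg, Set.ncard_eq_toFinset_card _ (hG p.1)]
            exact Finset.card_filter_le _ _
        _ ≤ 1 := mul_inv_le_one
    · intro p _ q _ hpq
      rw [Function.onFun, Finset.disjoint_left]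
      intro z hz hz'
      simp only [Finset.mem_image] at hz hz'
      obtain ⟨a, -, rfl⟩ := hz
      obtain ⟨b, -, hb⟩ := hz'
      have := (Prod.ext_iff.1 hb).2
      simp only [List.cons.injEq] at this
      exact hpq (Prod.ext this.1.symm this.2.symm)

/-- If the average of `log deg` over the animals is at most `a`, then the number of self-avoiding
paths with `n` steps is at most `exp (a * (n + 1))`. -/
theorem card_saws_le {x : W} {n : ℕ} (hn : n ≠ 0) {g : ℕ → ℝ}
    (hlog : ∀ n : ℕ, 1 ≤ n → Real.log n ≤ g n) {a : ℝ}
    (ha : ∀ A ∈ animals G n x, degAverage G g A ≤ a) :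
    ((saws hG x n).card : ℝ) ≤ Real.exp (a * (n + 1)) := by
  classical
  have key : ∀ p ∈ saws hG x n,
      1 ≤ Real.exp (a * (n + 1)) * (p.2.map fun u => (deg G u : ℝ)⁻¹).prod := by
    intro p hp
    have hd := one_le_deg_of_mem_saws hG hp hn
    have hA := ha _ (toFinset_mem_animals hG hp)
    have hnd := nodup_of_mem_saws hG hp
    have hcard : ((p.1 :: p.2).toFinset.card : ℝ) = n + 1 := by
      rw [List.toFinset_card_of_nodup hnd, List.length_cons, length_of_mem_saws hG hp]
      push_cast; rfl
    rw [degAverage, hcard, inv_mul_le_iff₀ (by positivity)] at hA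
    have hpos : ∀ u ∈ p.1 :: p.2, (0 : ℝ) < deg G u := fun u hu => by
      exact_mod_cast hd u hu
    have h1 : ((p.1 :: p.2).map fun u => (deg G u : ℝ)).prod ≤ Real.exp (a * (n + 1)) := by
      rw [← List.prod_toFinset _ hnd]
      calc ∏ u ∈ (p.1 :: p.2).toFinset, (deg G u : ℝ)
          = ∏ u ∈ (p.1 :: p.2).toFinset, Real.exp (Real.log (deg G u)) :=
            Finset.prod_congr rfl fun u hu =>
              (Real.exp_log (hpos u (List.mem_toFinset.1 hu))).symm
        _ = Real.exp (∑ u ∈ (p.1 :: p.2).toFinset, Real.log (deg G u)) :=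
            (Real.exp_sum _ _).symm
        _ ≤ _ := by
            refine Real.exp_le_exp.2 (le_trans (Finset.sum_le_sum fun u hu =>
              hlog _ (hd u (List.mem_toFinset.1 hu))) ?_)
            linarith
    -- The walk never leaves the endpoint, so its weight omits that degree; the uncancelled factor
    -- is at least 1.
    have h2 : ((p.1 :: p.2).map fun u => (deg G u : ℝ)).prod *
        (p.2.map fun u => (deg G u : ℝ)⁻¹).prod = deg G p.1 := by
      rw [List.map_cons, List.prod_cons, mul_assoc, ← List.prod_map_mul]
      rw [List.prod_eq_one, mul_one]
      simp only [List.mem_map]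
      rintro _ ⟨u, hu, rfl⟩
      exact mul_inv_cancel₀ (hpos u (List.mem_cons_of_mem _ hu)).ne'
    calc (1 : ℝ) ≤ deg G p.1 := by exact_mod_cast hd _ List.mem_cons_self
      _ = _ := h2.symm
      _ ≤ _ := by
        refine mul_le_mul_of_nonneg_right h1 (List.prod_nonneg ?_)
        simp only [List.mem_map]; rintro _ ⟨u, -, rfl⟩; positivity
  calc ((saws hG x n).card : ℝ) = ∑ p ∈ saws hG x n, (1 : ℝ) := by simp
    _ ≤ ∑ p ∈ saws hG x n,
        Real.exp (a * (n + 1)) * (p.2.map fun u => (deg G u : ℝ)⁻¹).prod :=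
      Finset.sum_le_sum key
    _ ≤ Real.exp (a * (n + 1)) * 1 := by
      rw [← Finset.mul_sum]
      exact mul_le_mul_of_nonneg_left (sum_saws_prod_inv_deg_le hG x n) (Real.exp_pos _).le
    _ = _ := mul_one _

/-- Cut the path at `w`. The initial segment is open whenever the path is, because its vertices are
among those of the path. -/
theorem exists_saw_to_of_mem {x : W} {n : ℕ} {p : W × List W} (hp : p ∈ saws hG x n)
    {w : W} (hw : w ∈ p.1 :: p.2) :
    ∃ m, ∃ q ∈ saws hG x m, q.1 = w ∧ q.1 :: q.2 ⊆ p.1 :: p.2 := by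
  induction n generalizing p with
  | zero =>
    rw [mem_saws_zero] at hp
    subst hp
    simp only [List.mem_singleton] at hw
    exact ⟨0, (x, []), by simp [mem_saws_zero], hw.symm, List.Subset.refl _⟩
  | succ n ih =>
    rcases List.mem_cons.1 hw with rfl | hw
    · exact ⟨n + 1, p, hp, rfl, List.Subset.refl _⟩
    · obtain ⟨q, hq, h1, h2, h3⟩ := (mem_saws_succ hG).1 hp
      rw [h3] at hw
      obtain ⟨m, q', hq', h4, h5⟩ := ih hq hw
      exact ⟨m, q', hq', h4, fun u hu => h3 ▸ List.mem_cons_of_mem _ (h5 hu)⟩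

theorem exists_saw_of_le {x : W} {n m : ℕ} (hmn : m ≤ n) {p : W × List W}
    (hp : p ∈ saws hG x n) : ∃ q ∈ saws hG x m, q.1 :: q.2 ⊆ p.1 :: p.2 := by
  induction n generalizing p with
  | zero => obtain rfl := Nat.le_zero.1 hmn; exact ⟨p, hp, List.Subset.refl _⟩
  | succ n ih =>
    rcases Nat.of_le_succ hmn with h | rfl
    · obtain ⟨q, hq, h1, h2, h3⟩ := (mem_saws_succ hG).1 hp
      obtain ⟨q', hq', h5⟩ := ih h hq
      exact ⟨q', hq', fun u hu => h3 ▸ List.mem_cons_of_mem _ (h5 hu)⟩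
    · exact ⟨p, hp, List.Subset.refl _⟩

/-- The sum over the self-avoiding paths with `n` steps from `x` of the products of the weights of
their vertices. -/
noncomputable def sawSum (w : W → ℝ≥0∞) (x : W) (n : ℕ) : ℝ≥0∞ :=
  ∑ p ∈ saws hG x n, ((p.1 :: p.2).map w).prod

end Saw

/-- The exploration of the open clusters started from `I`: either they form a set `C` inside `D`, or
one of them contains a self-avoiding path of the prescribed length. -/
theorem DependenceHypergraph.exists_cluster_or_exists_saw {V : Type*} (H : DependenceHypergraph V)
    (I : Finset V) (D : Set V) (r : H.edges → ℕ) (hI : (I : Set V) ⊆ D)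
    (hD : ∀ e ∈ H.edgesMeeting I, ∀ n ≤ r e, ∀ p ∈ saws H.finite_neighborSet_lineGraph e n,
      ((p.1 : Finset V) : Set V) ⊆ D) (B : Finset H.edges) :
    (∃ C : Set V, (I : Set V) ⊆ C ∧ C ⊆ D ∧
      ∀ e ∈ B, ((e : Finset V) : Set V) ⊆ C ∨ Disjoint ((e : Finset V) : Set V) C) ∨
    ∃ e ∈ H.edgesMeeting I, ∃ p ∈ saws H.finite_neighborSet_lineGraph e (r e),
      ∀ u ∈ p.1 :: p.2, u ∈ B := by
  by_cases hS : ∃ e ∈ H.edgesMeeting I, ∃ p ∈ saws H.finite_neighborSet_lineGraph e (r e),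
      ∀ u ∈ p.1 :: p.2, u ∈ B
  · exact Or.inr hS
  -- The set `C` is `I` together with all hyperedges reached by open self-avoiding paths started at
  -- a hyperedge meeting `I`.
  refine Or.inl ⟨I ∪ {v | ∃ e ∈ H.edgesMeeting I, ∃ n, ∃ p ∈ saws H.finite_neighborSet_lineGraph e n,
    (∀ u ∈ p.1 :: p.2, u ∈ B) ∧ v ∈ (p.1 : Finset V)}, Set.subset_union_left, ?_, ?_⟩
  · refine Set.union_subset hI ?_
    rintro v ⟨e, he, n, p, hp, hpB, hv⟩
    rcases le_or_gt n (r e) with h | h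
    -- A longer open path would have an open initial segment of length exactly `r e`, which `hS`
    -- excludes.
    · exact hD e he n h p hp hv
    · obtain ⟨q, hq, hqp⟩ := exists_saw_of_le _ h.le hp
      exact absurd ⟨e, he, q, hq, fun u hu => hpB u (hqp hu)⟩ hS
  · intro e' he'
    rw [or_iff_not_imp_right, Set.not_disjoint_iff]
    rintro ⟨v, hve, hv | ⟨e, he, n, p, hp, hpB, hv⟩⟩
    · intro x hx
      refine Or.inr ⟨e', ⟨v, hv, hve⟩, 0, (e', []), by simp [mem_saws_zero], ?_, hx⟩
      simpa using he'
    · intro x hx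
      right
      -- The open hyperedge `e'` meets the endpoint of an open path. Either it lies on this path,
      -- which is then cut at `e'`, or it prolongs the path by one step.
      by_cases hmem : e' ∈ p.1 :: p.2
      · obtain ⟨m, q, hq, h1, h2⟩ := exists_saw_to_of_mem _ hp hmem
        exact ⟨e, he, m, q, hq, fun u hu => hpB u (h2 hu), by rw [h1]; exact hx⟩
      · refine ⟨e, he, n + 1, (e', p.1 :: p.2), (mem_saws_succ _).2 ⟨p, hp, ⟨?_, v, hv, hve⟩, hmem,
          rfl⟩, ?_, hx⟩
        · rintro rfl; exact hmem List.mem_cons_self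
        · intro u hu
          rcases List.mem_cons.1 hu with rfl | hu
          · exact he'
          · exact hpB u hu

/-! ### Pasting configurations -/

section Paste

variable {V S : Type*}

open Classical in
/-- The configuration equal to `ζ` on `C` and to `σ` off `C`. -/
noncomputable def paste (C : Set V) (ζ σ : V → S) : V → S := fun x => if x ∈ C then ζ x else σ x

theorem paste_of_mem {C : Set V} {x : V} (hx : x ∈ C) (ζ σ : V → S) : paste C ζ σ x = ζ x :=
  if_pos hx

theorem paste_of_notMem {C : Set V} {x : V} (hx : x ∉ C) (ζ σ : V → S) : paste C ζ σ x = σ x :=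
  if_neg hx

theorem paste_congr {C : Set V} {ζ ζ' σ σ' : V → S} {x : V} (h1 : x ∈ C → ζ x = ζ' x)
    (h2 : x ∉ C → σ x = σ' x) : paste C ζ σ x = paste C ζ' σ' x := by
  by_cases hx : x ∈ C
  · rw [paste_of_mem hx, paste_of_mem hx, h1 hx]
  · rw [paste_of_notMem hx, paste_of_notMem hx, h2 hx]

theorem paste_paste_of_subset {C D : Set V} (h : C ⊆ D) (ζ ζ' σ : V → S) :
    paste C ζ' (paste D ζ σ) = paste D (paste C ζ' ζ) σ := by
  funext x
  by_cases hC : x ∈ C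
  · rw [paste_of_mem hC, paste_of_mem (h hC), paste_of_mem hC]
  · by_cases hD : x ∈ D
    · rw [paste_of_notMem hC, paste_of_mem hD, paste_of_mem hD, paste_of_notMem hC]
    · rw [paste_of_notMem hC, paste_of_notMem hD, paste_of_notMem hD]

theorem glue_restrict (Λ : Finset V) (ζ σ : V → S) :
    glue Λ (Λ.restrict ζ) σ = paste (Λ : Set V) ζ σ := by
  funext x
  by_cases hx : x ∈ Λ
  · rw [paste_of_mem (Finset.mem_coe.2 hx)]; simp [glue, hx]
  · rw [paste_of_notMem (by simpa using hx)]; simp [glue, hx]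

variable [MeasurableSpace S]

theorem measurable_paste (C : Set V) :
    Measurable fun p : (V → S) × (V → S) => paste C p.1 p.2 := by
  refine measurable_pi_iff.2 fun x => ?_
  by_cases hx : x ∈ C
  · simp only [paste_of_mem hx]; fun_prop
  · simp only [paste_of_notMem hx]; fun_prop

theorem measurable_paste_left (C : Set V) (σ : V → S) : Measurable fun ζ => paste C ζ σ :=
  (measurable_paste C).comp (measurable_id.prodMk measurable_const)

theorem measurable_paste_right (C : Set V) (ζ : V → S) : Measurable fun σ => paste C ζ σ :=
  (measurable_paste C).comp (measurable_const.prodMk measurable_id)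

theorem measurable_paste_cylinderEvents (C : Set V) (σ : V → S) :
    Measurable[cylinderEvents (X := fun _ : V => S) C] fun ζ => paste C ζ σ := by
  refine (@measurable_pi_iff _ _ _ (cylinderEvents (X := fun _ : V => S) C) _ _).2 fun x => ?_
  by_cases hx : x ∈ C
  · simp only [paste_of_mem hx]
    exact measurable_cylinderEvent_apply hx
  · simp only [paste_of_notMem hx]
    exact measurable_const

/-- Such an `f` is unchanged by freezing the coordinates off `C`, and the freezing map is measurable
for the coordinates in `C`. -/
theorem measurable_cylinderEvents_of_forall_eq [Nonempty S] {β : Type*} [MeasurableSpace β]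
    {C : Set V} {f : (V → S) → β} (hf : Measurable f)
    (h : ∀ σ σ' : V → S, (∀ x ∈ C, σ x = σ' x) → f σ = f σ') :
    Measurable[cylinderEvents (X := fun _ : V => S) C] f := by
  obtain ⟨s⟩ := ‹Nonempty S›
  have : f = f ∘ fun ζ => paste C ζ fun _ => s :=
    funext fun σ => h _ _ fun x hx => (paste_of_mem hx _ _).symm
  rw [this]
  exact hf.comp (measurable_paste_cylinderEvents C _)

theorem mem_iff_of_measurableSet_cylinderEvents {C : Set V} {A : Set (V → S)}
    (hA : MeasurableSet[cylinderEvents (X := fun _ : V => S) C] A) {σ σ' : V → S}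
    (h : ∀ x ∈ C, σ x = σ' x) : σ ∈ A ↔ σ' ∈ A := by
  have hle : cylinderEvents (X := fun _ : V => S) C ≤
      MeasurableSpace.comap (fun ζ => paste C ζ σ) MeasurableSpace.pi := by
    refine iSup₂_le fun x hx => ?_
    rintro _ ⟨t, ht, rfl⟩
    refine ⟨(fun ζ => ζ x) ⁻¹' t, measurable_pi_apply x ht, ?_⟩
    ext ζ
    simp [paste_of_mem hx]
  obtain ⟨B, -, rfl⟩ := hle _ hA
  have : paste C σ σ = paste C σ' σ := funext fun x => paste_congr (h x) fun _ => rfl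
  simp only [Set.mem_preimage, this]

variable (χ : Measure S) [IsProbabilityMeasure χ]

/-- Exchanging the coordinates in `C` of two independent configurations preserves their law. -/
theorem measurePreserving_swap_paste (C : Set V) :
    MeasurePreserving (fun p : (V → S) × (V → S) => (paste C p.2 p.1, paste C p.1 p.2))
      ((Measure.infinitePi fun _ : V => χ).prod (Measure.infinitePi fun _ : V => χ))
      ((Measure.infinitePi fun _ : V => χ).prod (Measure.infinitePi fun _ : V => χ)) := by
  classical
  have hmeas : Measurable fun p : (V → S) × (V → S) => (paste C p.2 p.1, paste C p.1 p.2) :=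
    ((measurable_paste C).comp measurable_swap).prodMk (measurable_paste C)
  refine ⟨hmeas, ?_⟩
  symm
  have hpi : IsPiSystem (squareCylinders fun _ : V => {s : Set S | MeasurableSet s}) :=
    isPiSystem_squareCylinders (fun _ => MeasurableSpace.isPiSystem_measurableSet)
      fun _ => MeasurableSet.univ
  have hspan : (Measure.infinitePi fun _ : V => χ).FiniteSpanningSetsIn
      (squareCylinders fun _ : V => {s : Set S | MeasurableSet s}) :=
    { set := fun _ => Set.univ
      set_mem := fun _ => ⟨∅, fun _ => Set.univ, by simp, by simp⟩
      finite := fun _ => measure_lt_top _ _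
      spanning := Set.iUnion_const _ }
  refine Measure.prod_eq_generateFrom generateFrom_squareCylinders generateFrom_squareCylinders
    hpi hpi hspan hspan ?_
  have hsq : ∀ s ∈ squareCylinders fun _ : V => {s : Set S | MeasurableSet s},
      ∃ (I : Finset V) (a : V → Set S), (∀ x, MeasurableSet (a x)) ∧ (∀ x ∉ I, a x = Set.univ) ∧
        s = (I : Set V).pi a := by
    rintro _ ⟨I, a, ha, rfl⟩
    refine ⟨I, fun x => if x ∈ I then a x else Set.univ, fun x => ?_, fun x hx => if_neg hx, ?_⟩
    · by_cases hx : x ∈ I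
      · simpa [hx] using ha x (Set.mem_univ x)
      · simp [hx]
    · refine Set.pi_congr rfl fun x hx => ?_
      exact (if_pos hx).symm
  have hext : ∀ {I J : Finset V} {a : V → Set S}, (∀ x ∉ I, a x = Set.univ) →
      (I : Set V).pi a = ((I ∪ J : Finset V) : Set V).pi a := by
    intro I J a ha
    ext ζ
    simp only [Set.mem_pi, Finset.mem_coe, Finset.mem_union]
    refine ⟨fun h x _ => ?_, fun h x hx => h x (Or.inl hx)⟩
    by_cases hx : x ∈ I
    · exact h x hx
    · simp [ha x hx]
  intro s hs t ht
  obtain ⟨I, a, ha, hI, rfl⟩ := hsq s hs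
  obtain ⟨J, b, hb, hJ, rfl⟩ := hsq t ht
  rw [hext (J := J) hI, hext (J := I) hJ, Finset.union_comm J I]
  set K := I ∪ J
  -- Over a common finite base, the exchange just swaps the sides `a x` and `b x` for `x ∈ C`, so
  -- the product of their masses is unchanged.
  have hpre : (fun p : (V → S) × (V → S) => (paste C p.2 p.1, paste C p.1 p.2)) ⁻¹'
      ((K : Set V).pi a ×ˢ (K : Set V).pi b) =
      (K : Set V).pi (fun x => if x ∈ C then b x else a x) ×ˢ
        (K : Set V).pi (fun x => if x ∈ C then a x else b x) := by
    ext p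
    simp only [Set.mem_preimage, Set.mem_prod, Set.mem_pi, Finset.mem_coe, ← forall_and]
    refine forall₂_congr fun x _ => ?_
    by_cases hx : x ∈ C
    · simp only [paste_of_mem hx, if_pos hx]; tauto
    · simp only [paste_of_notMem hx, if_neg hx]
  have hK : ∀ c : V → Set S, (∀ x, MeasurableSet (c x)) → MeasurableSet ((K : Set V).pi c) :=
    fun c hc => MeasurableSet.pi K.countable_toSet fun x _ => hc x
  rw [Measure.map_apply hmeas ((hK a ha).prod (hK b hb)), hpre, Measure.prod_prod,
    Measure.infinitePi_pi _ (fun x _ => ha x), Measure.infinitePi_pi _ (fun x _ => hb x),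
    Measure.infinitePi_pi _ fun x _ => ?_, Measure.infinitePi_pi _ fun x _ => ?_,
    ← Finset.prod_mul_distrib, ← Finset.prod_mul_distrib]
  · refine Finset.prod_congr rfl fun x _ => ?_
    by_cases hx : x ∈ C
    · simp only [if_pos hx]; rw [mul_comm]
    · simp only [if_neg hx]
  · by_cases hx : x ∈ C
    · simpa [hx] using ha x
    · simpa [hx] using hb x
  · by_cases hx : x ∈ C
    · simpa [hx] using hb x
    · simpa [hx] using ha x

/-- The first marginal of the exchange: resampling the coordinates in `C` keeps the law. Consistency
of the kernels `indepKernel` follows. -/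
theorem lintegral_lintegral_paste (C : Set V) {f : (V → S) → ℝ≥0∞} (hf : Measurable f) :
    ∫⁻ ζ, ∫⁻ ζ', f (paste C ζ' ζ) ∂(Measure.infinitePi fun _ : V => χ)
      ∂(Measure.infinitePi fun _ : V => χ) = ∫⁻ ζ, f ζ ∂(Measure.infinitePi fun _ : V => χ) := by
  have h := (measurePreserving_swap_paste (V := V) χ C).lintegral_comp (hf.comp measurable_fst)
  rw [lintegral_prod _ (by
    exact ((hf.comp measurable_fst).comp (measurePreserving_swap_paste χ C).measurable).aemeasurable),
    lintegral_prod _ (hf.comp measurable_fst).aemeasurable] at h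
  simpa using h

theorem measurable_glue (Λ : Finset V) (σ : V → S) : Measurable fun ξ => glue Λ ξ σ := by
  refine measurable_pi_iff.2 fun x => ?_
  by_cases hx : x ∈ Λ
  · simp only [glue, hx, dif_pos]; fun_prop
  · simp only [glue, hx, dif_neg, not_false_eq_true]; fun_prop

/-- Realizes the kernels for all `Λ` and `σ` on one probability space, the infinite product, where
pasting and exchanging make sense for arbitrary sets of sites. -/
theorem indepKernel_eq_map (Λ : Finset V) (σ : V → S) :
    indepKernel χ Λ σ = (Measure.infinitePi fun _ : V => χ).map fun ζ => paste (Λ : Set V) ζ σ := by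
  rw [indepKernel, ← Measure.infinitePi_map_restrict (fun _ : V => χ),
    Measure.map_map (measurable_glue Λ σ) (Finset.measurable_restrict Λ)]
  congr 1
  funext ζ
  exact glue_restrict Λ ζ σ

theorem lintegral_indepKernel (Λ : Finset V) (σ : V → S) {f : (V → S) → ℝ≥0∞}
    (hf : Measurable f) : ∫⁻ η, f η ∂(indepKernel χ Λ σ) =
      ∫⁻ ζ, f (paste (Λ : Set V) ζ σ) ∂(Measure.infinitePi fun _ : V => χ) := by
  rw [indepKernel_eq_map, lintegral_map hf (measurable_paste_left _ σ)]

theorem lintegral_indepKernel_congr (Λ : Finset V) {σ σ' : V → S} {f : (V → S) → ℝ≥0∞}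
    (hf : Measurable f) {D : Set V} (hfD : ∀ η η' : V → S, (∀ x ∈ D, η x = η' x) → f η = f η')
    (h : ∀ x ∈ D, x ∉ Λ → σ x = σ' x) :
    ∫⁻ η, f η ∂(indepKernel χ Λ σ) = ∫⁻ η, f η ∂(indepKernel χ Λ σ') := by
  rw [lintegral_indepKernel χ Λ σ hf, lintegral_indepKernel χ Λ σ' hf]
  refine lintegral_congr fun ζ => hfD _ _ fun x hx => paste_congr (fun _ => rfl) fun hx' => ?_
  exact h x hx (by simpa using hx')

theorem measurable_lintegral_indepKernel (Λ : Finset V) {f : (V → S) → ℝ≥0∞}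
    (hf : Measurable f) : Measurable fun σ => ∫⁻ η, f η ∂(indepKernel χ Λ σ) := by
  simp only [lintegral_indepKernel χ Λ _ hf]
  exact Measurable.lintegral_prod_right' (f := fun p : (V → S) × (V → S) => f (paste Λ p.2 p.1))
    (hf.comp ((measurable_paste _).comp measurable_swap))

theorem lintegral_lintegral_indepKernel {Λ M : Finset V} (hΛ : Λ ⊆ M) (σ : V → S)
    {f : (V → S) → ℝ≥0∞} (hf : Measurable f) :
    ∫⁻ η, ∫⁻ η', f η' ∂(indepKernel χ Λ η) ∂(indepKernel χ M σ) =
      ∫⁻ η, f η ∂(indepKernel χ M σ) := by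
  rw [lintegral_indepKernel χ M σ (measurable_lintegral_indepKernel χ Λ hf),
    lintegral_indepKernel χ M σ hf]
  simp only [lintegral_indepKernel χ Λ _ hf, paste_paste_of_subset (Finset.coe_subset.2 hΛ)]
  exact lintegral_lintegral_paste χ Λ (hf.comp (measurable_paste_left _ σ))

/-- Factors depending on the configuration off `Λ` can be taken out of the integral. -/
theorem lintegral_indepKernel_mul_left (Λ : Finset V) (σ : V → S) {f u : (V → S) → ℝ≥0∞}
    (hf : Measurable f) (hu : Measurable u)
    (huΛ : ∀ η η' : V → S, (∀ x ∉ Λ, η x = η' x) → u η = u η') :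
    ∫⁻ η, u η * f η ∂(indepKernel χ Λ σ) = u σ * ∫⁻ η, f η ∂(indepKernel χ Λ σ) := by
  rw [lintegral_indepKernel χ Λ σ (f := fun η => u η * f η) (hu.mul hf), lintegral_indepKernel χ Λ σ hf,
    ← lintegral_const_mul _ (show Measurable fun ζ => f (paste (Λ : Set V) ζ σ) from
      hf.comp (measurable_paste_left _ σ))]
  refine lintegral_congr fun ζ => ?_
  congr 1
  exact huΛ _ _ fun x hx => paste_of_notMem (by simpa using hx) _ _

end Paste

/-! ### The specification -/

section Spec

variable {V S : Type*} [MeasurableSpace S] {H : DependenceHypergraph V}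

/-- The factors `h e` are measurable and bounded between the positive constants `m e` and `M e`. -/
structure HasBounds (h : ∀ e : H.edges, (↥e.1 → S) → ℝ) (m M : H.edges → ℝ) : Prop where
  measurable : ∀ e, Measurable (h e)
  pos : ∀ e, 0 < m e
  lower : ∀ e s, m e ≤ h e s
  upper : ∀ e s, h e s ≤ M e

/-- The factor of the hyperedge `e`, as a function of the configuration with values in `[0, ∞]`. -/
noncomputable def edgeWeight (h : ∀ e : H.edges, (↥e.1 → S) → ℝ) (e : H.edges) (η : V → S) :
    ℝ≥0∞ :=
  ENNReal.ofReal (h e (e.1.restrict η))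

theorem edgeWeight_congr (h : ∀ e : H.edges, (↥e.1 → S) → ℝ) {e : H.edges} {η η' : V → S}
    (hη : ∀ x ∈ (e : Finset V), η x = η' x) : edgeWeight h e η = edgeWeight h e η' := by
  rw [edgeWeight, edgeWeight]
  congr 2
  funext x
  exact hη x x.2

/-- The vertices in `I` or in a hyperedge meeting `Λ`. -/
def closureWith (H : DependenceHypergraph V) (Λ I : Finset V) : Set V :=
  {x | x ∈ I ∨ ∃ e ∈ H.edgesMeeting Λ, x ∈ (e : Finset V)}

theorem finite_closureWith (Λ I : Finset V) : (closureWith H Λ I).Finite := by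
  have : closureWith H Λ I = (I : Set V) ∪ ⋃ e ∈ H.edgesMeeting Λ, ((e : Finset V) : Set V) := by
    ext x; simp [closureWith]
  rw [this]
  exact I.finite_toSet.union ((H.finite_edgesMeeting Λ).biUnion fun e _ => e.1.finite_toSet)

variable {h : ∀ e : H.edges, (↥e.1 → S) → ℝ} {m M : H.edges → ℝ}

theorem spec_congr (χ : Measure S) [IsProbabilityMeasure χ]
    (h : ∀ e : H.edges, (↥e.1 → S) → ℝ) (Λ : Finset V) {σ σ' : V → S}
    (hσ : ∀ x ∉ Λ, σ x = σ' x) : spec H χ h Λ σ = spec H χ h Λ σ' := by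
  have : indepKernel χ Λ σ = indepKernel χ Λ σ' := by
    rw [indepKernel_eq_map, indepKernel_eq_map]
    congr 1
    funext ζ x
    exact paste_congr (fun _ => rfl) fun hx => hσ x (by simpa using hx)
  rw [spec, spec, this]

namespace HasBounds

theorem nonneg (hh : HasBounds h m M) (e : H.edges) (s : ↥e.1 → S) : 0 ≤ h e s :=
  (hh.pos e).le.trans (hh.lower e s)

theorem measurable_edgeWeight (hh : HasBounds h m M) (e : H.edges) :
    Measurable (edgeWeight h e) :=
  ENNReal.measurable_ofReal.comp ((hh.measurable e).comp (Finset.measurable_restrict _))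

theorem ofReal_preMod (hh : HasBounds h m M) (Λ : Finset V) (η : V → S) :
    ENNReal.ofReal (preMod H h Λ η) =
      ∏ e ∈ (H.finite_edgesMeeting Λ).toFinset, edgeWeight h e η :=
  ENNReal.ofReal_prod_of_nonneg fun e _ => hh.nonneg e _

theorem measurable_ofReal_preMod (hh : HasBounds h m M) (Λ : Finset V) :
    Measurable fun η => ENNReal.ofReal (preMod H h Λ η) := by
  simp only [hh.ofReal_preMod]
  exact Finset.measurable_fun_prod _ fun e _ => hh.measurable_edgeWeight e

theorem ofReal_preMod_congr (hh : HasBounds h m M) (Λ I : Finset V) {η η' : V → S}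
    (hη : ∀ x ∈ closureWith H Λ I, η x = η' x) :
    ENNReal.ofReal (preMod H h Λ η) = ENNReal.ofReal (preMod H h Λ η') := by
  rw [hh.ofReal_preMod, hh.ofReal_preMod]
  refine Finset.prod_congr rfl fun e he => edgeWeight_congr h fun x hx => hη x ?_
  exact Or.inr ⟨e, (Set.Finite.mem_toFinset _).1 he, hx⟩

variable (χ : Measure S) [IsProbabilityMeasure χ]

theorem partition_ne_zero (hh : HasBounds h m M) (Λ : Finset V) (σ : V → S) :
    ∫⁻ η, ENNReal.ofReal (preMod H h Λ η) ∂(indepKernel χ Λ σ) ≠ 0 := by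
  rw [lintegral_indepKernel χ Λ σ (hh.measurable_ofReal_preMod Λ)]
  have hle : ∫⁻ _, ENNReal.ofReal (∏ e ∈ (H.finite_edgesMeeting Λ).toFinset, m e)
      ∂(Measure.infinitePi fun _ : V => χ) ≤ ∫⁻ ζ, ENNReal.ofReal (preMod H h Λ (paste Λ ζ σ))
      ∂(Measure.infinitePi fun _ : V => χ) :=
    lintegral_mono fun ζ => ENNReal.ofReal_le_ofReal
      (Finset.prod_le_prod (fun e _ => (hh.pos e).le) fun e _ => hh.lower e _)
  rw [lintegral_const, measure_univ, mul_one] at hle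
  refine (lt_of_lt_of_le ?_ hle).ne'
  exact ENNReal.ofReal_pos.2 (Finset.prod_pos fun e _ => hh.pos e)

theorem partition_ne_top (hh : HasBounds h m M) (Λ : Finset V) (σ : V → S) :
    ∫⁻ η, ENNReal.ofReal (preMod H h Λ η) ∂(indepKernel χ Λ σ) ≠ ∞ := by
  rw [lintegral_indepKernel χ Λ σ (hh.measurable_ofReal_preMod Λ)]
  have hle : ∫⁻ ζ, ENNReal.ofReal (preMod H h Λ (paste Λ ζ σ))
      ∂(Measure.infinitePi fun _ : V => χ) ≤
      ∫⁻ _, ENNReal.ofReal (∏ e ∈ (H.finite_edgesMeeting Λ).toFinset, M e)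
        ∂(Measure.infinitePi fun _ : V => χ) :=
    lintegral_mono fun ζ => ENNReal.ofReal_le_ofReal
      (Finset.prod_le_prod (fun e _ => hh.nonneg e _) fun e _ => hh.upper e _)
  rw [lintegral_const, measure_univ, mul_one] at hle
  exact (hle.trans_lt ENNReal.ofReal_lt_top).ne

theorem lintegral_spec (hh : HasBounds h m M) (Λ : Finset V) (σ : V → S) {f : (V → S) → ℝ≥0∞}
    (hf : Measurable f) : ∫⁻ η, f η ∂(spec H χ h Λ σ) =
      (∫⁻ η, ENNReal.ofReal (preMod H h Λ η) ∂(indepKernel χ Λ σ))⁻¹ *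
        ∫⁻ η, ENNReal.ofReal (preMod H h Λ η) * f η ∂(indepKernel χ Λ σ) := by
  rw [spec, lintegral_smul_measure,
    lintegral_withDensity_eq_lintegral_mul _ (hh.measurable_ofReal_preMod Λ) hf]
  rfl

theorem isProbabilityMeasure_spec (hh : HasBounds h m M) (Λ : Finset V) (σ : V → S) :
    IsProbabilityMeasure (spec H χ h Λ σ) := by
  refine ⟨?_⟩
  rw [← lintegral_one, hh.lintegral_spec χ Λ σ measurable_const]
  simp only [mul_one]
  exact ENNReal.inv_mul_cancel (hh.partition_ne_zero χ Λ σ) (hh.partition_ne_top χ Λ σ)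

theorem measurable_lintegral_spec (hh : HasBounds h m M) (Λ : Finset V) {f : (V → S) → ℝ≥0∞}
    (hf : Measurable f) : Measurable fun σ => ∫⁻ η, f η ∂(spec H χ h Λ σ) := by
  simp only [hh.lintegral_spec χ Λ _ hf]
  exact (measurable_lintegral_indepKernel χ Λ (hh.measurable_ofReal_preMod Λ)).inv.mul
    (measurable_lintegral_indepKernel χ Λ ((hh.measurable_ofReal_preMod Λ).mul hf))

theorem measurable_spec_apply (hh : HasBounds h m M) (Λ : Finset V) {A : Set (V → S)}
    (hA : MeasurableSet A) : Measurable fun σ => spec H χ h Λ σ A := by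
  simpa only [lintegral_indicator_one hA] using
    hh.measurable_lintegral_spec χ Λ (measurable_one.indicator hA)

/-- The probability of a local event depends on the boundary condition near `Λ` only. -/
theorem spec_apply_congr (hh : HasBounds h m M) (Λ I : Finset V) {A : Set (V → S)}
    (hA : MeasurableSet[cylinderEvents (X := fun _ : V => S) (I : Set V)] A) {σ σ' : V → S}
    (hσ : ∀ x ∈ closureWith H Λ I, x ∉ Λ → σ x = σ' x) :
    spec H χ h Λ σ A = spec H χ h Λ σ' A := by
  have hA' : MeasurableSet A := cylinderEvents_le_pi _ hA
  have hind : ∀ η η' : V → S, (∀ x ∈ closureWith H Λ I, η x = η' x) →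
      A.indicator (1 : (V → S) → ℝ≥0∞) η = A.indicator 1 η' := by
    intro η η' hη
    have := mem_iff_of_measurableSet_cylinderEvents hA fun x hx => hη x (Or.inl hx)
    by_cases hmem : η ∈ A
    · rw [Set.indicator_of_mem hmem, Set.indicator_of_mem (this.1 hmem)]; rfl
    · rw [Set.indicator_of_notMem hmem, Set.indicator_of_notMem (mt this.2 hmem)]
  rw [← lintegral_indicator_one hA', ← lintegral_indicator_one hA',
    hh.lintegral_spec χ Λ _ (measurable_one.indicator hA'),
    hh.lintegral_spec χ Λ _ (measurable_one.indicator hA')]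
  have hF := hh.measurable_ofReal_preMod Λ
  congr 1
  · rw [lintegral_indepKernel_congr χ Λ hF (fun η η' hη => hh.ofReal_preMod_congr Λ I hη) hσ]
  · refine lintegral_indepKernel_congr χ Λ (hF.mul (measurable_one.indicator hA'))
      (fun η η' hη => ?_) hσ
    rw [hh.ofReal_preMod_congr Λ I hη, hind η η' hη]

theorem lintegral_spec_mul_left (hh : HasBounds h m M) (Λ : Finset V) (σ : V → S)
    {f u : (V → S) → ℝ≥0∞} (hf : Measurable f) (hu : Measurable u)
    (huΛ : ∀ η η' : V → S, (∀ x ∉ Λ, η x = η' x) → u η = u η') :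
    ∫⁻ η, u η * f η ∂(spec H χ h Λ σ) = u σ * ∫⁻ η, f η ∂(spec H χ h Λ σ) := by
  rw [hh.lintegral_spec χ Λ σ hf, hh.lintegral_spec χ Λ σ (f := fun η => u η * f η) (hu.mul hf)]
  simp only [mul_left_comm _ (u _)]
  rw [lintegral_indepKernel_mul_left χ Λ σ (f := fun η => ENNReal.ofReal (preMod H h Λ η) * f η)
    ((hh.measurable_ofReal_preMod Λ).mul hf) hu huΛ,
    mul_left_comm]

/-- Properness of the kernel: the configuration off `Λ` is frozen at `σ`, so events there act as
constants. -/
theorem spec_inter (hh : HasBounds h m M) (Λ : Finset V) (σ : V → S) {A B : Set (V → S)}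
    (hA : MeasurableSet A)
    (hB : MeasurableSet[cylinderEvents (X := fun _ : V => S) ((Λ : Set V)ᶜ)] B) :
    spec H χ h Λ σ (B ∩ A) = B.indicator (fun σ => spec H χ h Λ σ A) σ := by
  have hB' : MeasurableSet B := cylinderEvents_le_pi _ hB
  have := hh.lintegral_spec_mul_left χ Λ σ (f := A.indicator 1) (u := B.indicator 1)
    (measurable_one.indicator hA) (measurable_one.indicator hB') (fun η η' hη => by
      have := mem_iff_of_measurableSet_cylinderEvents hB fun x hx => hη x (by simpa using hx)
      by_cases hmem : η ∈ B
      · rw [Set.indicator_of_mem hmem, Set.indicator_of_mem (this.1 hmem)]; rfl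
      · rw [Set.indicator_of_notMem hmem, Set.indicator_of_notMem (mt this.2 hmem)])
  rw [lintegral_indicator_one hA] at this
  rw [← lintegral_indicator_one (hB'.inter hA), Set.inter_indicator_one]
  simp only [Pi.mul_apply]
  rw [this]
  by_cases hmem : σ ∈ B <;> simp [hmem]

/-- The kernels of the specification are consistent. -/
theorem lintegral_lintegral_spec (hh : HasBounds h m M) {Λ M' : Finset V} (hΛ : Λ ⊆ M')
    (σ : V → S) {f : (V → S) → ℝ≥0∞} (hf : Measurable f) :
    ∫⁻ η, ∫⁻ η', f η' ∂(spec H χ h Λ η) ∂(spec H χ h M' σ) = ∫⁻ η, f η ∂(spec H χ h M' σ) := by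
  classical
  have hFΛ := hh.measurable_ofReal_preMod Λ
  have hFM := hh.measurable_ofReal_preMod M'
  set E := (H.finite_edgesMeeting Λ).toFinset
  set E' := (H.finite_edgesMeeting M').toFinset
  have hEE : E ⊆ E' := by
    intro e he
    obtain ⟨x, hx, hxe⟩ := (Set.Finite.mem_toFinset _).1 he
    exact (Set.Finite.mem_toFinset _).2 ⟨x, hΛ hx, hxe⟩
  -- The hyperedges meeting `M'` but not `Λ` do not see the coordinates in `Λ`, so `G` is a constant
  -- for the kernel of `Λ`.
  let G : (V → S) → ℝ≥0∞ := fun η => ∏ e ∈ E' \ E, edgeWeight h e η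
  have hG : Measurable G := Finset.measurable_fun_prod _ fun e _ => hh.measurable_edgeWeight e
  have hfac : ∀ η, ENNReal.ofReal (preMod H h M' η) = G η * ENNReal.ofReal (preMod H h Λ η) :=
    fun η => by
      rw [hh.ofReal_preMod, hh.ofReal_preMod]
      exact (Finset.prod_sdiff hEE).symm
  have hGΛ : ∀ η η' : V → S, (∀ x ∉ Λ, η x = η' x) → G η = G η' := fun η η' hη =>
    Finset.prod_congr rfl fun e he => edgeWeight_congr h fun x hx => hη x fun hxΛ =>
      (Finset.mem_sdiff.1 he).2 ((Set.Finite.mem_toFinset _).2 ⟨x, hxΛ, hx⟩)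
  have hgf := hh.measurable_lintegral_spec χ Λ hf
  rw [hh.lintegral_spec χ M' σ hgf, hh.lintegral_spec χ M' σ hf]
  congr 1
  -- Resample `Λ` on both sides; the integrands then agree pointwise, as the partition function of
  -- `Λ` cancels.
  refine (lintegral_lintegral_indepKernel χ hΛ σ (hFM.mul hgf)).symm.trans <|
    Eq.trans ?_ (lintegral_lintegral_indepKernel χ hΛ σ (hFM.mul hf))
  refine lintegral_congr fun η => ?_
  simp only [Pi.mul_apply, hfac]
  have h1 : ∫⁻ η', G η' * ENNReal.ofReal (preMod H h Λ η') * f η' ∂(indepKernel χ Λ η) =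
      G η * ∫⁻ η', ENNReal.ofReal (preMod H h Λ η') * f η' ∂(indepKernel χ Λ η) := by
    simp only [mul_assoc]
    exact lintegral_indepKernel_mul_left χ Λ η (hFΛ.mul hf) hG hGΛ
  have h2 : ∫⁻ η', G η' * ENNReal.ofReal (preMod H h Λ η') * (∫⁻ η'', f η'' ∂(spec H χ h Λ η'))
        ∂(indepKernel χ Λ η) =
      G η * ((∫⁻ η'', f η'' ∂(spec H χ h Λ η)) *
        ∫⁻ η', ENNReal.ofReal (preMod H h Λ η') ∂(indepKernel χ Λ η)) := by
    rw [← lintegral_indepKernel_mul_left χ Λ η hFΛ hgf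
      (fun η η' hη => by rw [spec_congr χ h Λ hη])]
    refine Eq.trans ?_ (lintegral_indepKernel_mul_left χ Λ η (hgf.mul hFΛ) hG hGΛ)
    exact lintegral_congr fun η' => by ring
  rw [h1, h2, hh.lintegral_spec χ Λ η hf, mul_right_comm, ENNReal.inv_mul_cancel
    (hh.partition_ne_zero χ Λ η) (hh.partition_ne_top χ Λ η), one_mul]

end HasBounds

end Spec

/-! ### Disagreement percolation -/

/-- In the expansion of `∏ (W + k)` over the subsets of `E`, those containing `T` contribute at most
`∏ P` over `T` times the whole product, if `W ≤ P (W + k)`. -/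
theorem sum_expansion_superset_le {ι : Type*} [DecidableEq ι] (E T : Finset ι)
    {W k F P : ι → ℝ≥0∞} (hF : ∀ e, W e + k e = F e) (hP : ∀ e, W e ≤ P e * F e) :
    ∑ B ∈ E.powerset.filter (T ⊆ ·), (∏ e ∈ B, W e) * ∏ e ∈ E \ B, k e ≤
      (∏ e ∈ T, P e) * ∏ e ∈ E, F e := by
  by_cases hT : T ⊆ E
  · calc ∑ B ∈ E.powerset.filter (T ⊆ ·), (∏ e ∈ B, W e) * ∏ e ∈ E \ B, k e
        = ∑ B ∈ E.powerset.filter (T ⊆ ·),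
            (∏ e ∈ B, W e) * ∏ e ∈ E \ B, (if e ∈ T then 0 else k e) := by
          refine Finset.sum_congr rfl fun B hB => ?_
          -- For `B ⊇ T` no factor `k e` has `e ∈ T`, so these may be set to 0; the sum over all `B`
          -- is then again a product.
          congr 1
          refine Finset.prod_congr rfl fun e he => ?_
          rw [if_neg fun heT => (Finset.mem_sdiff.1 he).2 ((Finset.mem_filter.1 hB).2 heT)]
      _ ≤ ∑ B ∈ E.powerset, (∏ e ∈ B, W e) * ∏ e ∈ E \ B, (if e ∈ T then 0 else k e) :=
          Finset.sum_le_sum_of_subset (Finset.filter_subset _ _)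
      _ = ∏ e ∈ E, (W e + if e ∈ T then 0 else k e) := (Finset.prod_add _ _ _).symm
      _ ≤ ∏ e ∈ E, ((if e ∈ T then P e else 1) * F e) := by
          refine Finset.prod_le_prod' fun e _ => ?_
          by_cases he : e ∈ T
          · simpa [he] using hP e
          · simp [he, hF e]
      _ = (∏ e ∈ T, P e) * ∏ e ∈ E, F e := by
          rw [Finset.prod_mul_distrib, Finset.prod_ite_mem, Finset.inter_eq_right.2 hT]
  · rw [Finset.filter_false_of_mem fun B hB hTB => hT (hTB.trans (Finset.mem_powerset.1 hB))]
    simp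

namespace HasBounds

variable {V S : Type*} [MeasurableSpace S] {H : DependenceHypergraph V}
  {h : ∀ e : H.edges, (↥e.1 → S) → ℝ} {m M : H.edges → ℝ}
  (χ : Measure S) [IsProbabilityMeasure χ]

/-- The influence of the boundary condition on an event in `I`: if two boundary conditions agree on
`D`, it is at most the expected number of open self-avoiding paths of the given lengths which start
at `I`, for the percolation in which `e` is open with probability `p e`. -/
theorem spec_apply_le (hh : HasBounds h m M) {p : H.edges → ℝ}
    (hp : ∀ e s s', h e s * h e s' ≤ m e ^ 2 + p e * (h e s * h e s'))
    (I : Finset V) (D : Set V) (r : H.edges → ℕ) (hI : (I : Set V) ⊆ D)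
    (hD : ∀ e ∈ H.edgesMeeting I, ∀ n ≤ r e, ∀ q ∈ saws H.finite_neighborSet_lineGraph e n,
      ((q.1 : Finset V) : Set V) ⊆ D)
    (Λ : Finset V) {σ σ' : V → S} (hσ : ∀ x ∈ D, x ∉ Λ → σ x = σ' x) {A : Set (V → S)}
    (hA : MeasurableSet[cylinderEvents (X := fun _ : V => S) (I : Set V)] A) :
    spec H χ h Λ σ A ≤ spec H χ h Λ σ' A + ∑ e ∈ (H.finite_edgesMeeting I).toFinset,
      sawSum H.finite_neighborSet_lineGraph (fun e => ENNReal.ofReal (p e)) e (r e) := by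
  classical
  have hA' : MeasurableSet A := cylinderEvents_le_pi _ hA
  set π := Measure.infinitePi fun _ : V => χ
  set E := (H.finite_edgesMeeting Λ).toFinset
  set EI := (H.finite_edgesMeeting I).toFinset
  set P : H.edges → ℝ≥0∞ := fun e => ENNReal.ofReal (p e)
  let η : (V → S) × (V → S) → V → S := fun z => paste Λ z.1 σ
  let η' : (V → S) × (V → S) → V → S := fun z => paste Λ z.2 σ'
  have hη : Measurable η := (measurable_paste_left _ σ).comp measurable_fst
  have hη' : Measurable η' := (measurable_paste_left _ σ').comp measurable_snd
  let F : H.edges → (V → S) × (V → S) → ℝ≥0∞ := fun e z =>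
    edgeWeight h e (η z) * edgeWeight h e (η' z)
  have hF : ∀ e, Measurable (F e) := fun e =>
    ((hh.measurable_edgeWeight e).comp hη).mul ((hh.measurable_edgeWeight e).comp hη')
  -- Closed hyperedges carry `k`, which ignores the configurations; open ones carry `W`. As
  -- subtraction truncates, `W + k = F` uses `m e ^ 2 ≤ F e`.
  let k : H.edges → ℝ≥0∞ := fun e => ENNReal.ofReal (m e ^ 2)
  let W : H.edges → (V → S) × (V → S) → ℝ≥0∞ := fun e z => F e z - k e
  have hWm : ∀ e, Measurable (W e) := fun e => (hF e).sub measurable_const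
  have hFreal : ∀ e z, F e z =
      ENNReal.ofReal (h e (e.1.restrict (η z)) * h e (e.1.restrict (η' z))) := fun e z =>
    (ENNReal.ofReal_mul (hh.nonneg e _)).symm
  have hkF : ∀ e z, W e z + k e = F e z := fun e z => by
    refine tsub_add_cancel_of_le ?_
    change ENNReal.ofReal (m e ^ 2) ≤ F e z
    rw [hFreal, pow_two]
    exact ENNReal.ofReal_le_ofReal (mul_le_mul (hh.lower e _) (hh.lower e _) (hh.pos e).le
      (hh.nonneg e _))
  have hWP : ∀ e z, W e z ≤ P e * F e z := fun e z => by
    refine tsub_le_iff_left.2 ?_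
    rw [hFreal]
    refine (ENNReal.ofReal_le_ofReal (hp e _ _)).trans (ENNReal.ofReal_add_le.trans ?_)
    gcongr
    rw [ENNReal.ofReal_mul' (mul_nonneg (hh.nonneg e _) (hh.nonneg e _))]
  let t : Finset H.edges → (V → S) × (V → S) → ℝ≥0∞ := fun B z =>
    (∏ e ∈ B, W e z) * ∏ e ∈ E \ B, k e
  have ht : ∀ B, Measurable (t B) := fun B =>
    (Finset.measurable_fun_prod _ fun e _ => hWm e).mul_const _
  have hsum : ∀ z, ∑ B ∈ E.powerset, t B z = ∏ e ∈ E, F e z := fun z => by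
    rw [← Finset.prod_add]
    exact Finset.prod_congr rfl fun e _ => hkF e z
  let bad : Finset H.edges → Prop := fun B =>
    ∃ e ∈ H.edgesMeeting I, ∃ q ∈ saws H.finite_neighborSet_lineGraph e (r e),
      ∀ u ∈ q.1 :: q.2, u ∈ B
  set δ := ∑ e ∈ EI, sawSum H.finite_neighborSet_lineGraph P e (r e)
  have hbad : ∀ z, ∑ B ∈ E.powerset, (if bad B then t B z else 0) ≤ δ * ∏ e ∈ E, F e z := by
    intro z
    -- Union bound over the open paths that make `B` bad, followed by the estimate for the sets `B`
    -- containing a given path.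
    calc ∑ B ∈ E.powerset, (if bad B then t B z else 0)
        ≤ ∑ B ∈ E.powerset, ∑ e ∈ EI, ∑ q ∈ saws H.finite_neighborSet_lineGraph e (r e),
            (if (q.1 :: q.2).toFinset ⊆ B then t B z else 0) := by
          refine Finset.sum_le_sum fun B _ => ?_
          split_ifs with hB
          · obtain ⟨e, he, q, hq, hqB⟩ := hB
            have h1 : t B z ≤ if (q.1 :: q.2).toFinset ⊆ B then t B z else 0 :=
              (if_pos fun u hu => hqB u (List.mem_toFinset.1 hu)).ge
            refine h1.trans (le_trans ?_ (Finset.single_le_sum (fun _ _ => zero_le)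
              ((Set.Finite.mem_toFinset _).2 he : e ∈ EI)))
            exact Finset.single_le_sum
              (f := fun q : H.edges × List H.edges =>
                if (q.1 :: q.2).toFinset ⊆ B then t B z else 0) (fun _ _ => zero_le) hq
          · exact zero_le
      _ = ∑ e ∈ EI, ∑ q ∈ saws H.finite_neighborSet_lineGraph e (r e),
            ∑ B ∈ E.powerset.filter ((q.1 :: q.2).toFinset ⊆ ·), t B z := by
          rw [Finset.sum_comm]
          refine Finset.sum_congr rfl fun e _ => ?_
          rw [Finset.sum_comm]
          exact Finset.sum_congr rfl fun q _ => (Finset.sum_filter _ _).symm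
      _ ≤ ∑ e ∈ EI, ∑ q ∈ saws H.finite_neighborSet_lineGraph e (r e),
            ((q.1 :: q.2).map P).prod * ∏ e ∈ E, F e z := by
          refine Finset.sum_le_sum fun e _ => Finset.sum_le_sum fun q hq => ?_
          rw [← List.prod_toFinset _ (nodup_of_mem_saws _ hq)]
          exact sum_expansion_superset_le E _ (fun e => hkF e z) fun e => hWP e z
      _ = δ * ∏ e ∈ E, F e z := by
          simp only [δ, sawSum, Finset.sum_mul]
  have hind : Measurable fun ζ => A.indicator (1 : (V → S) → ℝ≥0∞) ζ :=
    measurable_one.indicator hA'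
  have hAt : ∀ B, Measurable fun z => A.indicator 1 (η z) * t B z := fun B =>
    (hind.comp hη).mul (ht B)
  have hAt' : ∀ B, Measurable fun z => A.indicator 1 (η' z) * t B z := fun B =>
    (hind.comp hη').mul (ht B)
  have hgood : ∀ B, ¬ bad B → ∫⁻ z, A.indicator 1 (η z) * t B z ∂(π.prod π) =
      ∫⁻ z, A.indicator 1 (η' z) * t B z ∂(π.prod π) := by
    intro B hB
    obtain ⟨C, hIC, hCD, hC⟩ := (H.exists_cluster_or_exists_saw I D r hI hD B).resolve_right hB
    let T : (V → S) × (V → S) → (V → S) × (V → S) := fun z =>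
      (paste C z.2 z.1, paste C z.1 z.2)
    -- On `C` the exchange trades `η` for `η'` even off `Λ`, because `σ` and `σ'` agree on `D \ Λ`
    -- and `C ⊆ D`.
    have hTη : ∀ z, ∀ x ∈ C, η (T z) x = η' z x := fun z x hx => by
      refine paste_congr (fun _ => paste_of_mem hx _ _) fun hxΛ => ?_
      exact hσ x (hCD hx) (by simpa using hxΛ)
    have hTη' : ∀ z, ∀ x ∈ C, η' (T z) x = η z x := fun z x hx => by
      refine paste_congr (fun _ => paste_of_mem hx _ _) fun hxΛ => ?_
      exact (hσ x (hCD hx) (by simpa using hxΛ)).symm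
    have hTo : ∀ z, ∀ x ∉ C, η (T z) x = η z x := fun z x hx =>
      paste_congr (fun _ => paste_of_notMem hx _ _) fun _ => rfl
    have hTo' : ∀ z, ∀ x ∉ C, η' (T z) x = η' z x := fun z x hx =>
      paste_congr (fun _ => paste_of_notMem hx _ _) fun _ => rfl
    have hTt : ∀ z, t B (T z) = t B z := fun z => by
      simp only [t, W, F]
      congr 1
      refine Finset.prod_congr rfl fun e he => ?_
      congr 1
      -- An open hyperedge inside `C` has its two factors exchanged, and one disjoint from `C` keeps
      -- both; `W` is symmetric. No closed hyperedge matters, even if it straddles `C`.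
      rcases hC e he with h1 | h1
      · rw [edgeWeight_congr h fun x hx => hTη z x (h1 hx),
          edgeWeight_congr h fun x hx => hTη' z x (h1 hx), mul_comm]
      · rw [edgeWeight_congr h fun x hx => hTo z x (Set.disjoint_left.1 h1 hx),
          edgeWeight_congr h fun x hx => hTo' z x (Set.disjoint_left.1 h1 hx)]
    have hTA : ∀ z, A.indicator (1 : (V → S) → ℝ≥0∞) (η (T z)) = A.indicator 1 (η' z) := by
      intro z
      have := mem_iff_of_measurableSet_cylinderEvents hA fun x hx => hTη z x (hIC hx)
      by_cases hmem : η' z ∈ A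
      · rw [Set.indicator_of_mem hmem, Set.indicator_of_mem (this.2 hmem)]; rfl
      · rw [Set.indicator_of_notMem hmem, Set.indicator_of_notMem (mt this.1 hmem)]
    have := (measurePreserving_swap_paste (V := V) χ C).lintegral_comp (hAt B)
    refine this.symm.trans (lintegral_congr fun z => ?_)
    change A.indicator 1 (η (T z)) * t B (T z) = _
    rw [hTt, hTA]
  have hFprod : ∀ z, ∏ e ∈ E, F e z = ENNReal.ofReal (preMod H h Λ (η z)) *
      ENNReal.ofReal (preMod H h Λ (η' z)) := fun z => by
    rw [hh.ofReal_preMod, hh.ofReal_preMod, ← Finset.prod_mul_distrib]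
  have hprod_meas : Measurable fun z => ∏ e ∈ E, F e z :=
    Finset.measurable_fun_prod _ fun e _ => hF e
  have key : ∫⁻ z, A.indicator 1 (η z) * ∏ e ∈ E, F e z ∂(π.prod π) ≤
      ∫⁻ z, A.indicator 1 (η' z) * ∏ e ∈ E, F e z ∂(π.prod π) +
        δ * ∫⁻ z, ∏ e ∈ E, F e z ∂(π.prod π) := by
    calc ∫⁻ z, A.indicator 1 (η z) * ∏ e ∈ E, F e z ∂(π.prod π)
        = ∑ B ∈ E.powerset, ∫⁻ z, A.indicator 1 (η z) * t B z ∂(π.prod π) := by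
          rw [← lintegral_finsetSum _ fun B _ => hAt B]
          exact lintegral_congr fun z => by rw [← hsum, Finset.mul_sum]
      _ ≤ ∑ B ∈ E.powerset, (∫⁻ z, A.indicator 1 (η' z) * t B z ∂(π.prod π) +
            ∫⁻ z, (if bad B then t B z else 0) ∂(π.prod π)) := by
          refine Finset.sum_le_sum fun B _ => ?_
          by_cases hB : bad B
          · refine le_trans (lintegral_mono fun z => ?_) le_add_self
            rw [if_pos hB]
            refine mul_le_of_le_one_left zero_le ?_
            exact Set.indicator_le_self' (fun _ _ => zero_le) _
          · rw [hgood B hB]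
            exact le_self_add
      _ = ∫⁻ z, A.indicator 1 (η' z) * ∏ e ∈ E, F e z ∂(π.prod π) +
            ∫⁻ z, ∑ B ∈ E.powerset, (if bad B then t B z else 0) ∂(π.prod π) := by
          rw [Finset.sum_add_distrib, ← lintegral_finsetSum _ fun B _ => hAt' B,
            ← lintegral_finsetSum]
          · congr 1
            exact lintegral_congr fun z => by rw [← hsum, Finset.mul_sum]
          · intro B _
            by_cases hB : bad B
            · simpa only [if_pos hB] using ht B
            · simp only [if_neg hB]; exact measurable_const
      _ ≤ _ := by
          gcongr
          rw [← lintegral_const_mul _ hprod_meas]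
          exact lintegral_mono hbad
  have hFm := hh.measurable_ofReal_preMod Λ
  have hf1 : ∀ τ : V → S, Measurable fun ζ => ENNReal.ofReal (preMod H h Λ (paste Λ ζ τ)) :=
    fun τ => hFm.comp (measurable_paste_left _ τ)
  have hf2 : ∀ τ : V → S, Measurable fun ζ => ENNReal.ofReal (preMod H h Λ (paste Λ ζ τ)) *
      A.indicator 1 (paste Λ ζ τ) :=
    fun τ => (hf1 τ).mul (hind.comp (measurable_paste_left _ τ))
  -- By independence each double integral factorizes; dividing by both partition functions turns
  -- `key` into the claim.
  have e1 := lintegral_prod_mul (μ := π) (ν := π) (hf2 σ).aemeasurable (hf1 σ').aemeasurable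
  have e2 := lintegral_prod_mul (μ := π) (ν := π) (hf1 σ).aemeasurable (hf2 σ').aemeasurable
  have e3 := lintegral_prod_mul (μ := π) (ν := π) (hf1 σ).aemeasurable (hf1 σ').aemeasurable
  have k1 : ∫⁻ z, A.indicator 1 (η z) * ∏ e ∈ E, F e z ∂(π.prod π) = _ :=
    (lintegral_congr fun z => by rw [hFprod]; simp only [η, η']; ring).trans e1
  have k2 : ∫⁻ z, A.indicator 1 (η' z) * ∏ e ∈ E, F e z ∂(π.prod π) = _ :=
    (lintegral_congr fun z => by rw [hFprod]; simp only [η, η']; ring).trans e2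
  have k3 : ∫⁻ z, ∏ e ∈ E, F e z ∂(π.prod π) = _ :=
    (lintegral_congr fun z => by rw [hFprod]).trans e3
  rw [k1, k2, k3] at key
  have hFA : Measurable fun η => ENNReal.ofReal (preMod H h Λ η) * A.indicator 1 η :=
    hFm.mul hind
  have hZ0 := hh.partition_ne_zero χ Λ
  have hZt := hh.partition_ne_top χ Λ
  rw [← lintegral_indicator_one hA', ← lintegral_indicator_one hA',
    hh.lintegral_spec χ Λ _ (measurable_one.indicator hA'),
    hh.lintegral_spec χ Λ _ (measurable_one.indicator hA'),
    lintegral_indepKernel χ Λ σ hFA, lintegral_indepKernel χ Λ σ' hFA]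
  simp only [lintegral_indepKernel χ Λ _ hFm] at hZ0 hZt ⊢
  generalize (∫⁻ ζ, ENNReal.ofReal (preMod H h Λ (paste Λ ζ σ)) *
      A.indicator 1 (paste Λ ζ σ) ∂π) = X at key ⊢
  generalize (∫⁻ ζ, ENNReal.ofReal (preMod H h Λ (paste Λ ζ σ')) *
      A.indicator 1 (paste Λ ζ σ') ∂π) = X' at key ⊢
  have a1 := hZ0 σ
  have a2 := hZ0 σ'
  have a3 := hZt σ
  have a4 := hZt σ'
  generalize (∫⁻ ζ, ENNReal.ofReal (preMod H h Λ (paste Λ ζ σ)) ∂π) = Z at key a1 a3 ⊢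
  generalize (∫⁻ ζ, ENNReal.ofReal (preMod H h Λ (paste Λ ζ σ')) ∂π) = Z' at key a2 a4 ⊢
  have i1 := ENNReal.inv_mul_cancel a1 a3
  have i2 := ENNReal.inv_mul_cancel a2 a4
  calc Z⁻¹ * X = (Z'⁻¹ * Z') * (Z⁻¹ * X) := by rw [i2, one_mul]
    _ = (Z⁻¹ * Z'⁻¹) * (X * Z') := by ring
    _ ≤ (Z⁻¹ * Z'⁻¹) * (Z * X' + δ * (Z * Z')) := by gcongr
    _ = (Z⁻¹ * Z) * (Z'⁻¹ * X') + δ * ((Z⁻¹ * Z) * (Z'⁻¹ * Z')) := by ring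
    _ = Z'⁻¹ * X' + δ := by rw [i1, i2]; simp

end HasBounds

/-! ### Limits of measures -/

open Filter Topology in
/-- A net of probability measures which is Cauchy uniformly over all events converges uniformly over
all events. -/
theorem exists_measure_of_cauchy {X ι : Type*} [MeasurableSpace X] [SemilatticeSup ι] [Nonempty ι]
    (ν : ι → Measure X) [∀ i, IsProbabilityMeasure (ν i)]
    (hν : ∀ ε : ℝ≥0∞, ε ≠ 0 → ∃ D, ∀ i ≥ D, ∀ j ≥ D, ∀ B, MeasurableSet B → ν i B ≤ ν j B + ε) :
    ∃ Q : Measure X, IsProbabilityMeasure Q ∧ ∀ ε : ℝ≥0∞, ε ≠ 0 → ∃ D, ∀ i ≥ D, ∀ B,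
      MeasurableSet B → Q B ≤ ν i B + ε ∧ ν i B ≤ Q B + ε := by
  obtain ⟨m, hm⟩ : ∃ m : Set X → ℝ≥0∞, ∀ ε : ℝ≥0∞, ε ≠ 0 → ∃ D, ∀ i ≥ D, ∀ B, MeasurableSet B →
      m B ≤ ν i B + ε ∧ ν i B ≤ m B + ε := by
    -- The upper limit is only a convenient candidate; the Cauchy condition makes it a uniform limit
    -- on measurable sets.
    refine ⟨fun B => limsup (fun i => ν i B) atTop, fun ε hε => ?_⟩
    obtain ⟨D, hD⟩ := hν ε hε
    refine ⟨D, fun i hi B hB => ⟨?_, ?_⟩⟩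
    · refine limsup_le_of_le (h := ?_)
      filter_upwards [eventually_ge_atTop D] with j hj using hD j hj i hi B hB
    · refine tsub_le_iff_right.1 ?_
      refine le_limsup_of_frequently_le (Eventually.frequently ?_)
      filter_upwards [eventually_ge_atTop D] with j hj
      exact tsub_le_iff_right.2 (hD i hi j hj B hB)
  have hm_top : ∀ B, MeasurableSet B → m B ≠ ∞ := by
    intro B hB
    obtain ⟨D, hD⟩ := hm 1 one_ne_zero
    exact ne_top_of_le_ne_top (by finiteness) (hD D le_rfl B hB).1
  have hlim : ∀ B, MeasurableSet B → Tendsto (fun i => ν i B) atTop (𝓝 (m B)) := by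
    intro B hB
    refine (ENNReal.tendsto_nhds (hm_top B hB)).2 fun ε hε => ?_
    obtain ⟨D, hD⟩ := hm ε hε.ne'
    filter_upwards [eventually_ge_atTop D] with i hi
    exact ⟨tsub_le_iff_right.2 (hD i hi B hB).1, (hD i hi B hB).2⟩
  have hm_empty : m ∅ = 0 := tendsto_nhds_unique (hlim ∅ .empty) (by simp)
  have hm_fin : ∀ (f : ℕ → Set X), (∀ n, MeasurableSet (f n)) → Pairwise (Function.onFun Disjoint f) →
      ∀ k : ℕ, m (⋃ n ∈ Finset.range k, f n) = ∑ n ∈ Finset.range k, m (f n) := by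
    intro f hf hd k
    refine tendsto_nhds_unique (hlim _ (Finset.measurableSet_biUnion _ fun n _ => hf n)) ?_
    have : ∀ i, ν i (⋃ n ∈ Finset.range k, f n) = ∑ n ∈ Finset.range k, ν i (f n) := fun i =>
      measure_biUnion_finset (fun a _ b _ hab => hd hab) fun n _ => hf n
    simp only [this]
    exact tendsto_finsetSum _ fun n _ => hlim _ (hf n)
  have hm_iUnion : ∀ ⦃f : ℕ → Set X⦄, (∀ n, MeasurableSet (f n)) →
      Pairwise (Function.onFun Disjoint f) → m (⋃ n, f n) = ∑' n, m (f n) := by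
    intro f hf hd
    refine le_antisymm ?_ ?_
    · refine ENNReal.le_of_forall_pos_le_add fun ε hε _ => ?_
      have hε3 : (ε / 3 : ℝ≥0∞) ≠ 0 := by simp [hε.ne']
      -- Uniformity over events supplies one index `D` serving both the whole union and a partial
      -- union; the last third of `ε` pays for the tail under `ν D`.
      obtain ⟨D, hD⟩ := hm _ hε3
      have hsum : ∑' n, ν D (f n) ≠ ∞ := by
        rw [← measure_iUnion hd hf]; exact measure_ne_top _ _
      have htail := ENNReal.tendsto_sum_nat_add _ hsum
      obtain ⟨k, hk⟩ := ((ENNReal.tendsto_nhds_zero.1 htail) _ hε3.bot_lt).exists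
      have hk' : MeasurableSet (⋃ n ∈ Finset.range k, f n) :=
        Finset.measurableSet_biUnion _ fun n _ => hf n
      have hthird : (ε : ℝ≥0∞) / 3 + ε / 3 + ε / 3 = ε := ENNReal.add_thirds _
      have h1 := (hD D le_rfl _ (MeasurableSet.iUnion hf)).1
      have h2 := (hD D le_rfl _ hk').2
      have h3 : ν D (⋃ n, f n) = ∑ n ∈ Finset.range k, ν D (f n) + ∑' n, ν D (f (n + k)) := by
        rw [measure_iUnion hd hf]
        exact (ENNReal.summable.sum_add_tsum_nat_add' (f := fun n => ν D (f n))).symm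
      have h4 : ν D (⋃ n ∈ Finset.range k, f n) = ∑ n ∈ Finset.range k, ν D (f n) :=
        measure_biUnion_finset (fun a _ b _ hab => hd hab) fun n _ => hf n
      rw [h4, hm_fin f hf hd] at h2
      have h5 : ∑ n ∈ Finset.range k, m (f n) ≤ ∑' n, m (f n) := ENNReal.sum_le_tsum _
      calc m (⋃ n, f n) ≤ ν D (⋃ n, f n) + ε / 3 := h1
        _ ≤ ((∑' n, m (f n) + ε / 3) + ε / 3) + ε / 3 :=
          add_le_add_left (h3.le.trans (add_le_add (h2.trans (add_le_add_left h5 _)) hk)) _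
        _ = ∑' n, m (f n) + ε := by rw [add_assoc, add_assoc, ← add_assoc (_ / 3), hthird]
    · refine ENNReal.tsum_le_of_sum_range_le fun k => ?_
      rw [← hm_fin f hf hd]
      refine le_of_tendsto_of_tendsto' (hlim _ (Finset.measurableSet_biUnion _ fun n _ => hf n))
        (hlim _ (.iUnion hf)) fun i => measure_mono ?_
      exact Set.iUnion₂_subset fun n _ => Set.subset_iUnion f n
  let Q : Measure X := Measure.ofMeasurable (fun B _ => m B) hm_empty hm_iUnion
  have hQ : ∀ B, MeasurableSet B → Q B = m B := fun B hB => Measure.ofMeasurable_apply B hB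
  refine ⟨Q, ⟨?_⟩, fun ε hε => ?_⟩
  · rw [hQ _ .univ]
    exact tendsto_nhds_unique (hlim _ .univ) (by simp)
  · obtain ⟨D, hD⟩ := hm ε hε
    exact ⟨D, fun i hi B hB => by rw [hQ B hB]; exact hD i hi B hB⟩

open Finset Preorder in
/-- Kolmogorov's extension theorem for sequences in a standard Borel space. -/
theorem exists_measure_map_frestrictLe_eq {S : Type*} [MeasurableSpace S] [StandardBorelSpace S]
    [Nonempty S] (Q : ∀ n : ℕ, Measure (Iic n → S)) [∀ n, IsProbabilityMeasure (Q n)]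
    (hQ : ∀ n, (Q (n + 1)).map (frestrictLe₂ (π := fun _ => S) n.le_succ) = Q n) :
    ∃ μ : Measure (ℕ → S), IsProbabilityMeasure μ ∧
      ∀ n, μ.map (frestrictLe (π := fun _ => S) n) = Q n := by
  let u : ∀ n : ℕ, (Iic (n + 1) → S) → (Iic n → S) × S := fun n z =>
    (frestrictLe₂ (π := fun _ => S) n.le_succ z, z ⟨n + 1, mem_Iic.2 le_rfl⟩)
  have hu : ∀ n, Measurable (u n) := fun n =>
    (measurable_frestrictLe₂ (X := fun _ => S) n.le_succ).prodMk
      (measurable_pi_apply (⟨n + 1, mem_Iic.2 le_rfl⟩ : Iic (n + 1)))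
  let ρ : ∀ n : ℕ, Measure ((Iic n → S) × S) := fun n => (Q (n + 1)).map (u n)
  have hρ : ∀ n, IsProbabilityMeasure (ρ n) := fun n =>
    Measure.isProbabilityMeasure_map (hu n).aemeasurable
  have hfst : ∀ n, (ρ n).fst = Q n := fun n => by
    rw [Measure.fst, Measure.map_map measurable_fst (hu n), ← hQ n]
    rfl
  -- In a standard Borel space the law of the next coordinate disintegrates over the past, so the
  -- Ionescu-Tulcea measure built from these kernels has the prescribed marginals.
  let κ : ∀ n : ℕ, Kernel (Iic n → S) S := fun n => (ρ n).condKernel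
  let v : ∀ n : ℕ, (Iic n → S) × S → (Iic (n + 1) → S) := fun n z =>
    IicProdIoc (X := fun _ => S) n (n + 1)
      (z.1, MeasurableEquiv.piSingleton (X := fun _ => S) n z.2)
  have hv : ∀ n, Measurable (v n) := fun n =>
    measurable_IicProdIoc.comp (measurable_fst.prodMk
      ((MeasurableEquiv.piSingleton (X := fun _ => S) n).measurable.comp measurable_snd))
  have hvu : ∀ n z, v n (u n z) = z := fun n z => by
    funext i
    simp only [v, u, IicProdIoc]
    split_ifs with h
    · rfl
    · have : i = ⟨n + 1, mem_Iic.2 le_rfl⟩ :=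
        Subtype.ext (le_antisymm (mem_Iic.1 i.2) (Nat.succ_le_of_lt (not_le.1 h)))
      subst this
      rfl
  have hstep : ∀ n, (Q n).bind (Kernel.partialTraj (X := fun _ => S) κ n (n + 1)) = Q (n + 1) := by
    intro n
    have h1 : (Q n ⊗ₘ κ n).map (v n) = Q (n + 1) := by
      rw [← hfst n, (ρ n).disintegrate (κ n), Measure.map_map (hv n) (hu n)]
      rw [show v n ∘ u n = id from funext (hvu n), Measure.map_id]
    rw [← h1]
    ext s hs
    rw [Measure.bind_apply hs (Kernel.aemeasurable _), Measure.map_apply (hv n) hs,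
      Measure.compProd_apply (hv n hs)]
    refine lintegral_congr fun x => ?_
    have hκ := Kernel.IsMarkovKernel.map (κ n)
      (MeasurableEquiv.piSingleton (X := fun _ => S) n).measurable
    have hI : Measurable (IicProdIoc (X := fun _ => S) n (n + 1)) := measurable_IicProdIoc
    rw [Kernel.partialTraj_succ_self]
    refine (Kernel.map_apply' _ hI _ hs).trans ((Kernel.id_prod_apply' _ _ (hI hs)).trans ?_)
    exact Kernel.map_apply' _ (MeasurableEquiv.measurable _) _ (measurable_prodMk_left (hI hs))
  have hpart : ∀ n, (Q 0).bind (Kernel.partialTraj (X := fun _ => S) κ 0 n) = Q n := by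
    intro n
    induction n with
    | zero =>
      rw [Kernel.partialTraj_self]
      exact Measure.id_comp
    | succ n ih =>
      rw [Kernel.partialTraj_succ_eq_comp (zero_le), ← Measure.comp_assoc, ih, hstep]
  refine ⟨(Q 0).bind (Kernel.traj (X := fun _ => S) κ 0), inferInstance, fun n => ?_⟩
  rw [← hpart n, Measure.map_comp _ _ (measurable_frestrictLe n), Kernel.traj_map_frestrictLe]

/-- A net of random fields whose marginals on the finite sets of sites are Cauchy, uniformly over
events, has a limit. -/
theorem exists_local_limit {V S : Type*} [Countable V] [Infinite V] [MeasurableSpace S]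
    [StandardBorelSpace S] [Nonempty S] (ν : Finset V → Measure (V → S))
    [∀ M, IsProbabilityMeasure (ν M)]
    (hν : ∀ (I : Finset V) (ε : ℝ≥0∞), ε ≠ 0 → ∃ D : Finset V, ∀ M ⊇ D, ∀ M' ⊇ D, ∀ B,
      MeasurableSet[cylinderEvents (X := fun _ : V => S) (I : Set V)] B → ν M B ≤ ν M' B + ε) :
    ∃ μ : Measure (V → S), IsProbabilityMeasure μ ∧
      ∀ (I : Finset V) (ε : ℝ≥0∞), ε ≠ 0 → ∃ D : Finset V, ∀ M ⊇ D, ∀ B,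
        MeasurableSet[cylinderEvents (X := fun _ : V => S) (I : Set V)] B →
          μ B ≤ ν M B + ε ∧ ν M B ≤ μ B + ε := by
  classical
  obtain ⟨_⟩ := nonempty_denumerable V
  let e : V ≃ ℕ := Denumerable.eqv V
  let R : ∀ n : ℕ, (V → S) → (Finset.Iic n → S) := fun n σ i => σ (e.symm i)
  have hR : ∀ n, Measurable (R n) := fun n => by fun_prop
  let J : ℕ → Finset V := fun n => (Finset.Iic n).map e.symm.toEmbedding
  have hRJ : ∀ n, Measurable[cylinderEvents (X := fun _ : V => S) (J n : Set V)] (R n) := fun n =>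
    (@measurable_pi_iff _ _ _ (cylinderEvents (X := fun _ : V => S) (J n : Set V)) _ _).2 fun i =>
      measurable_cylinderEvent_apply (by simpa [J] using Finset.mem_Iic.1 i.2)
  have hJR : ∀ n, cylinderEvents (X := fun _ : V => S) (J n : Set V) ≤
      MeasurableSpace.comap (R n) MeasurableSpace.pi := fun n => by
    refine iSup₂_le fun x hx => ?_
    rintro _ ⟨t, ht, rfl⟩
    have hx' : e x ∈ Finset.Iic n := by
      obtain ⟨i, hi, rfl⟩ := Finset.mem_map.1 (Finset.mem_coe.1 hx)
      simpa using hi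
    refine ⟨(fun z => z ⟨e x, hx'⟩) ⁻¹' t, measurable_pi_apply _ ht, ?_⟩
    ext σ
    simp [R]
  have hlim : ∀ n, ∃ Q : Measure (Finset.Iic n → S), IsProbabilityMeasure Q ∧
      ∀ ε : ℝ≥0∞, ε ≠ 0 → ∃ D : Finset V, ∀ M ⊇ D, ∀ B, MeasurableSet B →
        Q B ≤ ν M (R n ⁻¹' B) + ε ∧ ν M (R n ⁻¹' B) ≤ Q B + ε := by
    intro n
    have : ∀ M, IsProbabilityMeasure ((ν M).map (R n)) := fun M =>
      Measure.isProbabilityMeasure_map (hR n).aemeasurable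
    obtain ⟨Q, hQ, hQ'⟩ := exists_measure_of_cauchy (fun M => (ν M).map (R n)) fun ε hε => by
      obtain ⟨D, hD⟩ := hν (J n) ε hε
      refine ⟨D, fun M hM M' hM' B hB => ?_⟩
      rw [Measure.map_apply (hR n) hB, Measure.map_apply (hR n) hB]
      exact hD M hM M' hM' _ (hRJ n hB)
    refine ⟨Q, hQ, fun ε hε => ?_⟩
    obtain ⟨D, hD⟩ := hQ' ε hε
    refine ⟨D, fun M hM B hB => ?_⟩
    simpa only [Measure.map_apply (hR n) hB] using hD M hM B hB
  choose Q hQ hQ' using hlim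
  have hproj : ∀ n, (Q (n + 1)).map (Preorder.frestrictLe₂ (π := fun _ => S) n.le_succ) = Q n := by
    intro n
    ext B hB
    have hm := Preorder.measurable_frestrictLe₂ (X := fun _ : ℕ => S) n.le_succ
    rw [Measure.map_apply hm hB]
    have hpre : R (n + 1) ⁻¹' (Preorder.frestrictLe₂ (π := fun _ => S) n.le_succ ⁻¹' B) =
        R n ⁻¹' B := rfl
    -- Both limits are within `ε` of the marginal of one and the same `ν M`, for `M` large enough
    -- for `n` and `n + 1`.
    have hcomp : ∀ ε : ℝ≥0∞, ε ≠ 0 →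
        Q (n + 1) (Preorder.frestrictLe₂ (π := fun _ => S) n.le_succ ⁻¹' B) ≤ Q n B + (ε + ε) ∧
        Q n B ≤ Q (n + 1) (Preorder.frestrictLe₂ (π := fun _ => S) n.le_succ ⁻¹' B) + (ε + ε) := by
      intro ε hε
      obtain ⟨D, hD⟩ := hQ' n ε hε
      obtain ⟨D', hD'⟩ := hQ' (n + 1) ε hε
      have h1 := hD (D ∪ D') Finset.subset_union_left B hB
      have h2 := hD' (D ∪ D') Finset.subset_union_right _ (hm hB)
      rw [hpre] at h2
      rw [← add_assoc, ← add_assoc]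
      exact ⟨h2.1.trans (by gcongr; exact h1.2), h1.1.trans (by gcongr; exact h2.2)⟩
    refine le_antisymm ?_ ?_
    · refine ENNReal.le_of_forall_pos_le_add fun ε hε _ => ?_
      simpa using (hcomp (ε / 2) (by simp [hε.ne'])).1
    · refine ENNReal.le_of_forall_pos_le_add fun ε hε _ => ?_
      simpa using (hcomp (ε / 2) (by simp [hε.ne'])).2
  obtain ⟨μ, hμ, hμQ⟩ := exists_measure_map_frestrictLe_eq Q hproj
  have hE : Measurable fun (τ : ℕ → S) (x : V) => τ (e x) := by fun_prop
  refine ⟨μ.map fun τ x => τ (e x), Measure.isProbabilityMeasure_map hE.aemeasurable,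
    fun I ε hε => ?_⟩
  obtain ⟨n, hn⟩ : ∃ n, I ⊆ J n := by
    refine ⟨I.sup e, fun x hx => Finset.mem_map.2 ⟨e x, Finset.mem_Iic.2 (Finset.le_sup hx), ?_⟩⟩
    simp
  obtain ⟨D, hD⟩ := hQ' n ε hε
  refine ⟨D, fun M hM B hB => ?_⟩
  obtain ⟨B', hB', rfl⟩ := hJR n _ (cylinderEvents_mono (Finset.coe_subset.2 hn) _ hB)
  have : (μ.map fun τ x => τ (e x)) (R n ⁻¹' B') = Q n B' := by
    rw [Measure.map_apply hE (hR n hB'), ← hμQ n,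
      Measure.map_apply (Preorder.measurable_frestrictLe n) hB']
    congr 1
    ext τ
    have : R n (fun x => τ (e x)) = Preorder.frestrictLe (π := fun _ => S) n τ := by
      funext i
      simp [R, Preorder.frestrictLe]
    simp only [Set.mem_preimage, this]
  rw [this]
  exact hD M hM B' hB'

/-! ### Small influence of the boundary condition: existence and uniqueness of the field -/

section Fields

variable {V S : Type*} [MeasurableSpace S] {H : DependenceHypergraph V}
  {h : ∀ e : H.edges, (↥e.1 → S) → ℝ} {m M : H.edges → ℝ}

/-- Boundary conditions which agree in a large finite set have a small influence on local events,
uniformly in the set of sites which are resampled. -/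
def HasSmallInfluence (H : DependenceHypergraph V) (χ : Measure S)
    (h : ∀ e : H.edges, (↥e.1 → S) → ℝ) : Prop :=
  ∀ (I : Finset V) (ε : ℝ≥0∞), ε ≠ 0 → ∃ D : Finset V, I ⊆ D ∧
    ∀ (Λ : Finset V) (σ σ' : V → S), (∀ x ∈ D, x ∉ Λ → σ x = σ' x) →
      ∀ A, MeasurableSet[cylinderEvents (X := fun _ : V => S) (I : Set V)] A →
        spec H χ h Λ σ A ≤ spec H χ h Λ σ' A + ε

theorem measurable_restrict_cylinderEvents_finset (I : Finset V) :
    Measurable[cylinderEvents (X := fun _ : V => S) (I : Set V)]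
      (I.restrict (π := fun _ : V => S)) :=
  (@measurable_pi_iff _ _ _ (cylinderEvents (X := fun _ : V => S) (I : Set V)) _ _).2 fun i =>
    measurable_cylinderEvent_apply i.2

theorem ext_of_cylinderEvents {μ ν : Measure (V → S)} [IsProbabilityMeasure μ]
    [IsProbabilityMeasure ν]
    (h : ∀ (I : Finset V) (A : Set (V → S)),
      MeasurableSet[cylinderEvents (X := fun _ : V => S) (I : Set V)] A → μ A = ν A) : μ = ν := by
  refine ext_of_generate_finite _ generateFrom_measurableCylinders.symm
    isPiSystem_measurableCylinders (fun A hA => ?_) (by simp)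
  obtain ⟨I, B, hB, rfl⟩ := (mem_measurableCylinders A).1 hA
  exact h I _ (measurable_restrict_cylinderEvents_finset I hB)

/-- Two measures which are uniformly close on a `σ`-algebra give close integrals to the functions
with values in `[0, 1]` which are measurable for it. -/
theorem lintegral_ofReal_le_add {X : Type*} {m1 m0 : MeasurableSpace X} (hm : m1 ≤ m0)
    {μ ν : Measure[m0] X} {ε : ℝ≥0∞} (hle : ∀ B, MeasurableSet[m1] B → μ B ≤ ν B + ε) {f : X → ℝ}
    (hf : Measurable[m1] f) (hf0 : ∀ x, 0 ≤ f x) (hf1 : ∀ x, f x ≤ 1) :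
    ∫⁻ x, ENNReal.ofReal (f x) ∂μ ≤ ∫⁻ x, ENNReal.ofReal (f x) ∂ν + ε := by
  have hfm : Measurable[m0] f := hf.mono hm le_rfl
  -- Layer-cake formula: levels above 1 are empty, so the error `ε` is integrated over an interval
  -- of length one.
  rw [lintegral_eq_lintegral_meas_lt μ (Filter.Eventually.of_forall hf0) hfm.aemeasurable,
    lintegral_eq_lintegral_meas_lt ν (Filter.Eventually.of_forall hf0) hfm.aemeasurable]
  calc ∫⁻ t in Set.Ioi (0 : ℝ), μ {x | t < f x}
      ≤ ∫⁻ t in Set.Ioi (0 : ℝ), (ν {x | t < f x} + (Set.Iio (1 : ℝ)).indicator (fun _ => ε) t) := by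
        refine lintegral_mono fun t => ?_
        by_cases ht : t < 1
        · rw [Set.indicator_of_mem (Set.mem_Iio.2 ht)]
          exact hle _ (hf measurableSet_Ioi)
        · have : {x | t < f x} = ∅ :=
            Set.eq_empty_of_forall_notMem fun x hx => ht (lt_of_lt_of_le hx (hf1 x))
          simp [this]
    _ = (∫⁻ t in Set.Ioi (0 : ℝ), ν {x | t < f x}) +
          ∫⁻ t in Set.Ioi (0 : ℝ), (Set.Iio (1 : ℝ)).indicator (fun _ => ε) t :=
        lintegral_add_right _ (measurable_const.indicator measurableSet_Iio)
    _ = (∫⁻ t in Set.Ioi (0 : ℝ), ν {x | t < f x}) + ε := by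
        congr 1
        rw [lintegral_indicator measurableSet_Iio, Measure.restrict_restrict measurableSet_Iio,
          lintegral_const, Measure.restrict_apply_univ, Set.inter_comm, Set.Ioi_inter_Iio]
        simp

variable {χ : Measure S} [IsProbabilityMeasure χ]

theorem HasBounds.measurable_spec (hh : HasBounds h m M) (Λ : Finset V) :
    Measurable fun σ => spec H χ h Λ σ :=
  Measure.measurable_of_measurable_coe _ fun _ hA => hh.measurable_spec_apply χ Λ hA

theorem HasBounds.measurable_real_spec (hh : HasBounds h m M) (Λ : Finset V) {A : Set (V → S)}
    (hA : MeasurableSet A) : Measurable fun σ => (spec H χ h Λ σ).real A :=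
  (hh.measurable_spec_apply χ Λ hA).ennreal_toReal

theorem HasBounds.integrable_real_spec (hh : HasBounds h m M) (Λ : Finset V) {A : Set (V → S)}
    (hA : MeasurableSet A) (μ : Measure (V → S)) [IsProbabilityMeasure μ] :
    Integrable (fun σ => (spec H χ h Λ σ).real A) μ := by
  have := hh.isProbabilityMeasure_spec χ Λ
  refine Integrable.of_bound (hh.measurable_real_spec Λ hA).aestronglyMeasurable 1
    (Filter.Eventually.of_forall fun σ => ?_)
  rw [Real.norm_of_nonneg measureReal_nonneg]
  exact measureReal_le_one

/-- The fields are the probability measures invariant under the kernels of the specification. -/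
theorem condExp_eq_spec_of_invariant [Nonempty S] (hh : HasBounds h m M) {μ : Measure (V → S)}
    [IsProbabilityMeasure μ] (Λ : Finset V)
    (hμ : ∀ A, MeasurableSet A → ∫⁻ σ, spec H χ h Λ σ A ∂μ = μ A) {A : Set (V → S)}
    (hA : MeasurableSet A) :
    μ⟦A | cylinderEvents (X := fun _ : V => S) ((Λ : Set V)ᶜ)⟧ =ᵐ[μ]
      fun σ => (spec H χ h Λ σ).real A := by
  have hint := hh.integrable_real_spec (χ := χ) Λ hA μ
  have hprob := hh.isProbabilityMeasure_spec χ Λ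
  symm
  refine ae_eq_condExp_of_forall_setIntegral_eq cylinderEvents_le_pi
    ((integrable_const (1 : ℝ)).indicator hA) (fun _ _ _ => hint.integrableOn) (fun B hB _ => ?_) ?_
  · have hB' : MeasurableSet B := cylinderEvents_le_pi _ hB
    have h1 : ∫⁻ σ in B, spec H χ h Λ σ A ∂μ = μ (B ∩ A) := by
      rw [← hμ _ (hB'.inter hA), ← lintegral_indicator hB']
      exact lintegral_congr fun σ => (hh.spec_inter χ Λ σ hA hB).symm
    rw [setIntegral_indicator hA, setIntegral_const, smul_eq_mul, mul_one]
    simp only [Measure.real]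
    rw [integral_toReal (hh.measurable_spec_apply χ Λ hA).aemeasurable
      (Filter.Eventually.of_forall fun σ => measure_lt_top _ _), h1]
  · suffices hm : Measurable[cylinderEvents (X := fun _ : V => S) ((Λ : Set V)ᶜ)]
        fun σ => (spec H χ h Λ σ).real A from hm.stronglyMeasurable.aestronglyMeasurable
    exact measurable_cylinderEvents_of_forall_eq (hh.measurable_real_spec Λ hA)
      fun σ σ' hσ => by rw [spec_congr χ h Λ fun x hx => hσ x (by simpa using hx)]

theorem lintegral_spec_of_mem_fields (hh : HasBounds h m M) {μ : Measure (V → S)}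
    (hμ : μ ∈ fields H χ h) {Λ : Finset V} (hΛ : Λ.Nonempty) {A : Set (V → S)}
    (hA : MeasurableSet A) : ∫⁻ σ, spec H χ h Λ σ A ∂μ = μ A := by
  have := hμ.1
  have hprob := hh.isProbabilityMeasure_spec χ Λ
  have h1 := integral_congr_ae (hμ.2 Λ hΛ A hA)
  rw [integral_condExp cylinderEvents_le_pi, integral_indicator_const _ hA, smul_eq_mul,
    mul_one] at h1
  simp only [Measure.real] at h1
  rw [integral_toReal (hh.measurable_spec_apply χ Λ hA).aemeasurable
    (Filter.Eventually.of_forall fun σ => measure_lt_top _ _)] at h1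
  refine ((ENNReal.toReal_eq_toReal_iff' (measure_ne_top _ _) ?_).1 h1).symm
  refine ne_top_of_le_ne_top ENNReal.one_ne_top ?_
  calc ∫⁻ σ, spec H χ h Λ σ A ∂μ ≤ ∫⁻ _, 1 ∂μ := lintegral_mono fun σ => prob_le_one
    _ = 1 := by simp

theorem lintegral_le_of_forall_le_add {X : Type*} [MeasurableSpace X] {μ : Measure X}
    [IsProbabilityMeasure μ] {f : X → ℝ≥0∞} {a ε : ℝ≥0∞} (hf : ∀ x, f x ≤ a + ε) :
    ∫⁻ x, f x ∂μ ≤ a + ε := by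
  calc ∫⁻ x, f x ∂μ ≤ ∫⁻ _, (a + ε) ∂μ := lintegral_mono hf
    _ = a + ε := by simp

theorem le_lintegral_of_forall_le_add {X : Type*} [MeasurableSpace X] {μ : Measure X}
    [IsProbabilityMeasure μ] {f : X → ℝ≥0∞} {a ε : ℝ≥0∞} (hf : ∀ x, a ≤ f x + ε) :
    a ≤ ∫⁻ x, f x ∂μ + ε := by
  calc a = ∫⁻ _, a ∂μ := by simp
    _ ≤ ∫⁻ x, (f x + ε) ∂μ := lintegral_mono hf
    _ = ∫⁻ x, f x ∂μ + ε := by rw [lintegral_add_right _ measurable_const]; simp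

/-- The field is unique. -/
theorem eq_of_mem_fields [Nonempty V] (hh : HasBounds h m M) (hsmall : HasSmallInfluence H χ h)
    {μ ν : Measure (V → S)} (hμ : μ ∈ fields H χ h) (hν : ν ∈ fields H χ h) : μ = ν := by
  classical
  have := hμ.1
  have := hν.1
  obtain ⟨x⟩ := ‹Nonempty V›
  obtain ⟨σ₀⟩ : Nonempty (V → S) := nonempty_of_isProbabilityMeasure μ
  have hle : ∀ {μ ν : Measure (V → S)}, μ ∈ fields H χ h → ν ∈ fields H χ h →
      ∀ (I : Finset V) (A : Set (V → S)),
        MeasurableSet[cylinderEvents (X := fun _ : V => S) (I : Set V)] A → μ A ≤ ν A := by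
    intro μ ν hμ hν I A hA
    have := hμ.1
    have := hν.1
    have hA' : MeasurableSet A := cylinderEvents_le_pi _ hA
    refine ENNReal.le_of_forall_pos_le_add fun ε hε _ => ?_
    obtain ⟨D, -, hD⟩ := hsmall I (ε / 2) (by simp [hε.ne'])
    have hΛ : (insert x D).Nonempty := Finset.insert_nonempty _ _
    -- Resampling all of `D` makes the agreement condition void, so any two boundary conditions
    -- compare. The site `x` only ensures that the set is nonempty.
    have key : ∀ σ σ', spec H χ h (insert x D) σ A ≤ spec H χ h (insert x D) σ' A + ε / 2 :=
      fun σ σ' => hD _ σ σ' (fun y hy hy' => absurd (Finset.mem_insert_of_mem hy) hy') A hA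
    calc μ A = ∫⁻ σ, spec H χ h (insert x D) σ A ∂μ :=
          (lintegral_spec_of_mem_fields hh hμ hΛ hA').symm
      _ ≤ spec H χ h (insert x D) σ₀ A + ε / 2 := lintegral_le_of_forall_le_add fun σ => key σ σ₀
      _ ≤ (∫⁻ σ, spec H χ h (insert x D) σ A ∂ν + ε / 2) + ε / 2 := by
          gcongr
          exact le_lintegral_of_forall_le_add fun σ => key σ₀ σ
      _ = ν A + ε := by
          rw [lintegral_spec_of_mem_fields hh hν hΛ hA', add_assoc, ENNReal.add_halves]
  exact ext_of_cylinderEvents fun I A hA => le_antisymm (hle hμ hν I A hA) (hle hν hμ I A hA)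

/-- A field exists. -/
theorem exists_mem_fields [Countable V] [Infinite V] [StandardBorelSpace S]
    (hh : HasBounds h m M) (hsmall : HasSmallInfluence H χ h) : ∃ μ, μ ∈ fields H χ h := by
  classical
  have hS : Nonempty S := nonempty_of_isProbabilityMeasure χ
  let σ₀ : V → S := fun _ => hS.some
  have hprob := fun Λ => hh.isProbabilityMeasure_spec χ Λ
  have hcons : ∀ {Λ N : Finset V}, Λ ⊆ N → ∀ σ A, MeasurableSet A →
      ∫⁻ η, spec H χ h Λ η A ∂(spec H χ h N σ) = spec H χ h N σ A := by
    intro Λ N hΛ σ A hA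
    have := hh.lintegral_lintegral_spec χ hΛ σ (measurable_one.indicator hA)
    simpa only [lintegral_indicator_one hA] using this
  obtain ⟨μ, hμ, hlim⟩ := exists_local_limit (fun N => spec H χ h N σ₀) (by
    intro I ε hε
    obtain ⟨D, -, hD⟩ := hsmall I (ε / 2) (by simp [hε])
    refine ⟨D, fun N hN N' hN' B hB => ?_⟩
    have hB' : MeasurableSet B := cylinderEvents_le_pi _ hB
    -- The volumes `N` and `N'` are compared through `N ∪ N'`, whose measure is invariant under both
    -- kernels.
    calc spec H χ h N σ₀ B ≤ ∫⁻ η, spec H χ h N η B ∂(spec H χ h (N ∪ N') σ₀) + ε / 2 :=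
          le_lintegral_of_forall_le_add fun η => hD N σ₀ η (fun y hy hy' => absurd (hN hy) hy') B hB
      _ = ∫⁻ η, spec H χ h N' η B ∂(spec H χ h (N ∪ N') σ₀) + ε / 2 := by
          rw [hcons Finset.subset_union_left _ _ hB', hcons Finset.subset_union_right _ _ hB']
      _ ≤ (spec H χ h N' σ₀ B + ε / 2) + ε / 2 := by
          gcongr
          exact lintegral_le_of_forall_le_add fun η =>
            hD N' η σ₀ (fun y hy hy' => absurd (hN' hy) hy') B hB
      _ = spec H χ h N' σ₀ B + ε := by rw [add_assoc, ENNReal.add_halves])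
  refine ⟨μ, hμ, fun Λ _ A hA => condExp_eq_spec_of_invariant hh Λ ?_ hA⟩
  have hbind : ∀ A, MeasurableSet A → μ.bind (fun σ => spec H χ h Λ σ) A =
      ∫⁻ σ, spec H χ h Λ σ A ∂μ := fun A hA =>
    Measure.bind_apply hA (hh.measurable_spec Λ).aemeasurable
  have hbprob : IsProbabilityMeasure (μ.bind fun σ => spec H χ h Λ σ) :=
    ⟨by rw [hbind _ .univ]; simp⟩
  have heq : μ.bind (fun σ => spec H χ h Λ σ) = μ := by
    refine ext_of_cylinderEvents fun I A hA => ?_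
    have hA' : MeasurableSet A := cylinderEvents_le_pi _ hA
    rw [hbind A hA']
    -- The kernel of `Λ` maps events in `I` to functions of the coordinates in the finite set `J`,
    -- so convergence on `J` suffices to pass to the limit in the invariance.
    let J : Finset V := (finite_closureWith (H := H) Λ I).toFinset
    have hmeas : Measurable[cylinderEvents (X := fun _ : V => S) (J : Set V)]
        fun σ => (spec H χ h Λ σ).real A :=
      measurable_cylinderEvents_of_forall_eq (hh.measurable_real_spec Λ hA') fun σ σ' hσ => by
        rw [Measure.real, Measure.real, hh.spec_apply_congr χ Λ I hA fun x hx _ => hσ x (by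
          simpa [J] using hx)]
    have hcomp : ∀ {μ₁ μ₂ : Measure (V → S)} {ε : ℝ≥0∞},
        (∀ B, MeasurableSet[cylinderEvents (X := fun _ : V => S) (J : Set V)] B →
          μ₁ B ≤ μ₂ B + ε) →
        ∫⁻ σ, spec H χ h Λ σ A ∂μ₁ ≤ ∫⁻ σ, spec H χ h Λ σ A ∂μ₂ + ε := by
      intro μ₁ μ₂ ε hle
      have := lintegral_ofReal_le_add cylinderEvents_le_pi hle hmeas
        (fun σ => measureReal_nonneg) fun σ => measureReal_le_one
      have hreal : ∀ σ, ENNReal.ofReal ((spec H χ h Λ σ).real A) = spec H χ h Λ σ A := fun σ =>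
        ofReal_measureReal
      simpa only [hreal] using this
    have hε2 : ∀ ε : ℝ≥0∞, ε ≠ 0 → ∫⁻ σ, spec H χ h Λ σ A ∂μ ≤ μ A + (ε + ε) ∧
        μ A ≤ ∫⁻ σ, spec H χ h Λ σ A ∂μ + (ε + ε) := by
      intro ε hε
      obtain ⟨D, hD⟩ := hlim J ε hε
      obtain ⟨D', hD'⟩ := hlim I ε hε
      let N := Λ ∪ (D ∪ D')
      have hΛN : Λ ⊆ N := Finset.subset_union_left
      have hDN : D ⊆ N := Finset.subset_union_left.trans Finset.subset_union_right
      have hDN' : D' ⊆ N := Finset.subset_union_right.trans Finset.subset_union_right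
      have h1 := hcomp fun B hB => (hD N hDN B hB).1
      have h2 := hcomp fun B hB => (hD N hDN B hB).2
      rw [hcons hΛN _ _ hA'] at h1 h2
      have h3 := hD' N hDN' A hA
      rw [← add_assoc, ← add_assoc]
      exact ⟨h1.trans (by gcongr; exact h3.2), h3.1.trans (by gcongr)⟩
    refine le_antisymm ?_ ?_
    · refine ENNReal.le_of_forall_pos_le_add fun ε hε _ => ?_
      simpa using (hε2 (ε / 2) (by simp [hε.ne'])).1
    · refine ENNReal.le_of_forall_pos_le_add fun ε hε _ => ?_
      simpa using (hε2 (ε / 2) (by simp [hε.ne'])).2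
  intro A hA
  rw [← hbind A hA, heq]

end Fields

/-! ### The global Markov property -/

/-- A function close to a measurable one is close to its conditional expectation. -/
theorem abs_condExp_sub_le {X : Type*} {m0 m : MeasurableSpace X} (hm : m0 ≤ m) {μ : Measure X}
    [IsProbabilityMeasure μ] {f G : X → ℝ} {ε : ℝ} (hf : Integrable f μ) (hG : Integrable G μ)
    (hGm : StronglyMeasurable[m0] G) (h : ∀ᵐ x ∂μ, |f x - G x| ≤ ε) :
    ∀ᵐ x ∂μ, |(μ[f | m0]) x - G x| ≤ ε := by
  have h1 : μ[f | m0] ≤ᵐ[μ] μ[G + fun _ => ε | m0] :=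
    condExp_mono hf (hG.add (integrable_const ε)) <| by
      filter_upwards [h] with x hx
      simp only [Pi.add_apply]
      linarith [(abs_le.1 hx).2]
  have h2 : μ[G - fun _ => ε | m0] ≤ᵐ[μ] μ[f | m0] :=
    condExp_mono (hG.sub (integrable_const ε)) hf <| by
      filter_upwards [h] with x hx
      simp only [Pi.sub_apply]
      linarith [(abs_le.1 hx).1]
  rw [condExp_of_stronglyMeasurable hm (hGm.add stronglyMeasurable_const)
    (hG.add (integrable_const ε))] at h1
  rw [condExp_of_stronglyMeasurable hm (hGm.sub stronglyMeasurable_const)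
    (hG.sub (integrable_const ε))] at h2
  filter_upwards [h1, h2] with x hx1 hx2
  simp only [Pi.add_apply, Pi.sub_apply] at hx1 hx2
  exact abs_le.2 ⟨by linarith, by linarith⟩

section Markov

variable {V S : Type*} [MeasurableSpace S]

/-- The events depending on finitely many coordinates in `Δ` generate the events in `Δ`. -/
theorem generateFrom_cylinderEvents_finset (Δ : Set V) :
    cylinderEvents (X := fun _ : V => S) Δ = MeasurableSpace.generateFrom
      {A | ∃ I : Finset V, (I : Set V) ⊆ Δ ∧
        MeasurableSet[cylinderEvents (X := fun _ : V => S) (I : Set V)] A} := by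
  refine le_antisymm ?_ (MeasurableSpace.generateFrom_le ?_)
  · refine iSup₂_le fun x hx => ?_
    rintro _ ⟨t, ht, rfl⟩
    refine MeasurableSpace.measurableSet_generateFrom ⟨{x}, by simpa using hx, ?_⟩
    exact measurable_cylinderEvent_apply (X := fun _ : V => S) (Δ := (({x} : Finset V) : Set V))
      (by simp) ht
  · rintro A ⟨I, hI, hA⟩
    exact cylinderEvents_mono hI _ hA

theorem isPiSystem_cylinderEvents_finset (Δ : Set V) :
    IsPiSystem {A : Set (V → S) | ∃ I : Finset V, (I : Set V) ⊆ Δ ∧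
      MeasurableSet[cylinderEvents (X := fun _ : V => S) (I : Set V)] A} := by
  classical
  rintro A ⟨I, hI, hA⟩ B ⟨J, hJ, hB⟩ -
  refine ⟨I ∪ J, by simpa using ⟨hI, hJ⟩, MeasurableSet.inter ?_ ?_⟩
  · exact cylinderEvents_mono (by simp) _ hA
  · exact cylinderEvents_mono (by simp) _ hB

/-- Two conditional probabilities which agree on the events depending on finitely many coordinates
in `Δ` agree on all events in `Δ`. -/
theorem condExp_indicator_congr [Countable V] [StandardBorelSpace S] {μ : Measure (V → S)}
    [IsProbabilityMeasure μ] (C₁ C₂ Δ : Set V)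
    (h : ∀ I : Finset V, (I : Set V) ⊆ Δ → ∀ A,
      MeasurableSet[cylinderEvents (X := fun _ : V => S) (I : Set V)] A →
        μ⟦A | cylinderEvents (X := fun _ : V => S) C₁⟧ =ᵐ[μ]
      μ⟦A | cylinderEvents (X := fun _ : V => S) C₂⟧) {A : Set (V → S)}
    (hA : MeasurableSet[cylinderEvents (X := fun _ : V => S) Δ] A) :
    μ⟦A | cylinderEvents (X := fun _ : V => S) C₁⟧ =ᵐ[μ]
      μ⟦A | cylinderEvents (X := fun _ : V => S) C₂⟧ := by
  -- Regular conditional probabilities are measures in the event, so almost sure agreement passes to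
  -- complements and countable disjoint unions.
  have hker : ∀ᵐ σ ∂μ, condExpKernel μ (cylinderEvents (X := fun _ : V => S) C₁) σ A =
      condExpKernel μ (cylinderEvents (X := fun _ : V => S) C₂) σ A := by
    induction A, hA using MeasurableSpace.induction_on_inter (generateFrom_cylinderEvents_finset Δ)
      (isPiSystem_cylinderEvents_finset Δ) with
    | empty => simp
    | basic A hA =>
      obtain ⟨I, hI, hA⟩ := hA
      have hA' : MeasurableSet A := cylinderEvents_le_pi _ hA
      filter_upwards [h I hI A hA, condExpKernel_ae_eq_condExp (cylinderEvents_le_pi (Δ := C₁)) (μ := μ) hA',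
        condExpKernel_ae_eq_condExp (cylinderEvents_le_pi (Δ := C₂)) (μ := μ) hA'] with σ h0 h1 h2
      rw [← measureReal_eq_measureReal_iff, h1, h2, h0]
    | compl A hA ih =>
      have hA' : MeasurableSet A := cylinderEvents_le_pi _ hA
      filter_upwards [ih] with σ hσ
      rw [prob_compl_eq_one_sub hA', prob_compl_eq_one_sub hA', hσ]
    | iUnion f hd hf ih =>
      have hf' : ∀ n, MeasurableSet (f n) := fun n => cylinderEvents_le_pi _ (hf n)
      filter_upwards [ae_all_iff.2 ih] with σ hσ
      rw [measure_iUnion hd hf', measure_iUnion hd hf']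
      simp only [hσ]
  have hA' : MeasurableSet A := cylinderEvents_le_pi _ hA
  filter_upwards [hker, condExpKernel_ae_eq_condExp (cylinderEvents_le_pi (Δ := C₁)) (μ := μ) hA',
    condExpKernel_ae_eq_condExp (cylinderEvents_le_pi (Δ := C₂)) (μ := μ) hA'] with σ h0 h1 h2
  rw [← h1, ← h2, Measure.real, Measure.real, h0]

variable {H : DependenceHypergraph V} {h : ∀ e : H.edges, (↥e.1 → S) → ℝ} {m M : H.edges → ℝ}
  {χ : Measure S} [IsProbabilityMeasure χ]

theorem boundary_subset_compl (Δ : Set V) : H.boundary Δ ⊆ Δᶜ := fun _ hx => hx.1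

/-- The global Markov property for events depending on finitely many coordinates. -/
theorem condExp_boundary_of_mem_fields (hh : HasBounds h m M) (hsmall : HasSmallInfluence H χ h)
    {μ : Measure (V → S)} (hμ : μ ∈ fields H χ h) {Δ : Set V} (hΔ : Δ.Nonempty) (I : Finset V)
    (hI : (I : Set V) ⊆ Δ) {A : Set (V → S)}
    (hA : MeasurableSet[cylinderEvents (X := fun _ : V => S) (I : Set V)] A) :
    μ⟦A | cylinderEvents (X := fun _ : V => S) Δᶜ⟧ =ᵐ[μ]
      μ⟦A | cylinderEvents (X := fun _ : V => S) (H.boundary Δ)⟧ := by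
  classical
  have := hμ.1
  have hS : Nonempty S := nonempty_of_isProbabilityMeasure χ
  obtain ⟨x₀, hx₀⟩ := hΔ
  have hA' : MeasurableSet A := cylinderEvents_le_pi _ hA
  have hprob := fun Λ => hh.isProbabilityMeasure_spec χ Λ
  let σ₀ : V → S := fun _ => hS.some
  set f := μ⟦A | cylinderEvents (X := fun _ : V => S) Δᶜ⟧ with hf
  set b := μ⟦A | cylinderEvents (X := fun _ : V => S) (H.boundary Δ)⟧ with hb
  have hbf : μ[f | cylinderEvents (X := fun _ : V => S) (H.boundary Δ)] =ᵐ[μ] b :=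
    condExp_condExp_of_le (cylinderEvents_mono (boundary_subset_compl Δ)) cylinderEvents_le_pi
  have key : ∀ ε : ℝ, 0 < ε → ∀ᵐ σ ∂μ, |f σ - b σ| ≤ 2 * ε := by
    intro ε hε
    -- Adding `x₀ ∈ Δ` forces `x₀ ∈ D`, so that `Λ = D ∩ Δ` is nonempty and the field condition
    -- applies to it.
    obtain ⟨D, hID, hD⟩ := hsmall (insert x₀ I) (ENNReal.ofReal ε) (by simpa using hε)
    let Λ : Finset V := D.filter (· ∈ Δ)
    have hΛΔ : ∀ x ∈ Λ, x ∈ Δ := fun x hx => (Finset.mem_filter.1 hx).2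
    have hΛ : Λ.Nonempty :=
      ⟨x₀, Finset.mem_filter.2 ⟨hID (Finset.mem_insert_self _ _), hx₀⟩⟩
    let g : (V → S) → ℝ := fun σ => (spec H χ h Λ σ).real A
    -- Freezing the spins in `Δ` changes nothing on `D \ Λ`, which lies outside `Δ`; hence `G` is
    -- within `ε` of `g`.
    let G : (V → S) → ℝ := fun σ => (spec H χ h Λ (paste Δ σ₀ σ)).real A
    have hgint : Integrable g μ := hh.integrable_real_spec Λ hA' μ
    have hGmeas : Measurable G := (hh.measurable_real_spec Λ hA').comp (measurable_paste_right _ _)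
    have hGint : Integrable G μ := by
      refine Integrable.of_bound hGmeas.aestronglyMeasurable 1
        (Filter.Eventually.of_forall fun σ => ?_)
      rw [Real.norm_of_nonneg measureReal_nonneg]
      exact measureReal_le_one
    have hGb : Measurable[cylinderEvents (X := fun _ : V => S) (H.boundary Δ)] G := by
      refine measurable_cylinderEvents_of_forall_eq hGmeas fun σ σ' hσ => ?_
      simp only [G, Measure.real]
      rw [hh.spec_apply_congr χ Λ I hA fun x hx hxΛ => paste_congr (fun _ => rfl) fun hxΔ => ?_]
      -- A site off `Δ` that the kernel reads shares a hyperedge with a site of `Λ ⊆ Δ`, so it lies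
      -- in the boundary.
      rcases hx with hx | ⟨e, ⟨y, hy, hye⟩, hxe⟩
      · exact absurd (hI hx) hxΔ
      · exact hσ x ⟨hxΔ, y, hΛΔ y hy, e, e.2, hye, hxe⟩
    have hle : ∀ σ σ', (∀ x ∈ D, x ∉ Λ → σ x = σ' x) →
        (spec H χ h Λ σ).real A ≤ (spec H χ h Λ σ').real A + ε := by
      intro σ σ' hσ
      have := hD Λ σ σ' hσ A
        (cylinderEvents_mono (by simp) _ hA)
      have h2 := ENNReal.toReal_mono (by finiteness) this
      rwa [ENNReal.toReal_add (measure_ne_top _ _) ENNReal.ofReal_ne_top,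
        ENNReal.toReal_ofReal hε.le] at h2
    have hpaste : ∀ σ, ∀ x ∈ D, x ∉ Λ → σ x = paste Δ σ₀ σ x := fun σ x hx hxΛ =>
      (paste_of_notMem (fun hxΔ => hxΛ (Finset.mem_filter.2 ⟨hx, hxΔ⟩)) _ _).symm
    have hgG : ∀ σ, |g σ - G σ| ≤ ε := fun σ => by
      have h1 := hle _ _ (hpaste σ)
      have h2 := hle _ _ fun x hx hxΛ => (hpaste σ x hx hxΛ).symm
      exact abs_le.2 ⟨by simp only [g, G]; linarith, by simp only [g, G]; linarith⟩
    -- Tower property, as `Δᶜ ⊆ Λᶜ`. Since `G` is measurable for the boundary, conditioning on `Δᶜ`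
    -- and then on the boundary keeps each result within `ε` of `G`.
    have hfg : μ[g | cylinderEvents (X := fun _ : V => S) Δᶜ] =ᵐ[μ] f := by
      refine (condExp_congr_ae (hμ.2 Λ hΛ A hA').symm).trans
        (condExp_condExp_of_le (cylinderEvents_mono ?_) cylinderEvents_le_pi)
      exact Set.compl_subset_compl.2 hΛΔ
    have h1 := abs_condExp_sub_le (cylinderEvents_le_pi (Δ := Δᶜ)) hgint hGint
      ((hGb.mono (cylinderEvents_mono (boundary_subset_compl Δ)) le_rfl).stronglyMeasurable)
      (Filter.Eventually.of_forall hgG)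
    have h2 : ∀ᵐ σ ∂μ, |f σ - G σ| ≤ ε := by
      filter_upwards [h1, hfg] with σ h3 h4
      rwa [← h4]
    have h3 := abs_condExp_sub_le (cylinderEvents_le_pi (Δ := H.boundary Δ)) integrable_condExp
      hGint hGb.stronglyMeasurable h2
    filter_upwards [h2, h3, hbf] with σ h4 h5 h6
    rw [h6] at h5
    have h4' := abs_le.1 h4
    have h5' := abs_le.1 h5
    exact abs_le.2 ⟨by linarith, by linarith⟩
  have hall : ∀ᵐ σ ∂μ, ∀ n : ℕ, |f σ - b σ| ≤ 2 * (1 / ((n : ℝ) + 1)) :=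
    ae_all_iff.2 fun n => key _ Nat.one_div_pos_of_nat
  filter_upwards [hall] with σ hσ
  have hlim : Filter.Tendsto (fun n : ℕ => 2 * (1 / ((n : ℝ) + 1))) Filter.atTop (nhds (2 * 0)) :=
    tendsto_one_div_add_atTop_nhds_zero_nat.const_mul 2
  have h0 := ge_of_tendsto' hlim hσ
  rw [mul_zero] at h0
  exact sub_eq_zero.1 (abs_nonpos_iff.1 h0)

theorem isGloballyMarkov_of_mem_fields [Countable V] [StandardBorelSpace S]
    (hh : HasBounds h m M) (hsmall : HasSmallInfluence H χ h)
    {μ : Measure (V → S)} (hμ : μ ∈ fields H χ h) : IsGloballyMarkov H μ := by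
  have := hμ.1
  intro Δ A hA
  refine condExp_indicator_congr _ _ Δ (fun I hI B hB => ?_) hA
  -- An empty `Δ` contains no nonempty `Λ`, but its events are trivial and lie in every σ-algebra.
  rcases Δ.eq_empty_or_nonempty with rfl | hΔ
  · have hB' : MeasurableSet B := cylinderEvents_le_pi _ hB
    have hconst : ∀ C : Set V, μ⟦B | cylinderEvents (X := fun _ : V => S) C⟧ =
        B.indicator fun _ => 1 := by
      intro C
      refine condExp_of_stronglyMeasurable cylinderEvents_le_pi ?_
        ((integrable_const (1 : ℝ)).indicator hB')
      exact stronglyMeasurable_const.indicator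
        (cylinderEvents_mono (hI.trans (Set.empty_subset C)) _ hB)
    rw [hconst, hconst]
  · exact condExp_boundary_of_mem_fields hh hsmall hμ hΔ I hI hB

end Markov

/-! ### Random weights -/

section Random

variable {W Ω : Type*} {G : SimpleGraph W} (hG : ∀ x, (G.neighborSet x).Finite)
  [MeasurableSpace Ω] {P : Measure Ω}

theorem measurable_sawSum {w : W → Ω → ℝ≥0∞} (hw : ∀ e, Measurable (w e)) (x : W) (n : ℕ) :
    Measurable fun ω => sawSum hG (fun e => w e ω) x n := by
  refine Finset.measurable_fun_sum _ fun p _ => ?_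
  induction p.1 :: p.2 with
  | nil => simp
  | cons u l ih =>
    simp only [List.map_cons, List.prod_cons]
    exact (hw u).mul ih

/-- The expected number of open self-avoiding paths. -/
theorem lintegral_sawSum_le {w : W → Ω → ℝ≥0∞} (hw : ∀ e, Measurable (w e)) (hind : iIndepFun w P)
    {q : ℝ≥0∞} (hq : ∀ e, ∫⁻ ω, w e ω ∂P ≤ q) (x : W) (n : ℕ) :
    ∫⁻ ω, sawSum hG (fun e => w e ω) x n ∂P ≤ (saws hG x n).card * q ^ (n + 1) := by
  classical
  have hprod : ∀ p ∈ saws hG x n, ∀ ω, ((p.1 :: p.2).map fun e => w e ω).prod =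
      ∏ e ∈ (p.1 :: p.2).toFinset, w e ω := fun p hp ω =>
    (List.prod_toFinset _ (nodup_of_mem_saws hG hp)).symm
  have hsum : ∀ ω, sawSum hG (fun e => w e ω) x n =
      ∑ p ∈ saws hG x n, ∏ e ∈ (p.1 :: p.2).toFinset, w e ω := fun ω =>
    Finset.sum_congr rfl fun p hp => hprod p hp ω
  simp only [hsum]
  rw [lintegral_finsetSum _ fun p _ => Finset.measurable_fun_prod _ fun e _ => hw e,
    ← nsmul_eq_mul]
  refine Finset.sum_le_card_nsmul _ _ _ fun p hp => ?_
  -- Self-avoidance is used here: the factors belong to distinct vertices, so independence makes the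
  -- mean multiplicative.
  rw [lintegral_prod_eq_prod_lintegral_of_indepFun _ _ hind hw]
  refine (Finset.prod_le_pow_card _ _ q fun e _ => hq e).trans_eq ?_
  rw [List.toFinset_card_of_nodup (nodup_of_mem_saws hG hp), List.length_cons,
    length_of_mem_saws hG hp]

/-- The means are bounded by a geometric sequence, because `N k ≥ k`. So the series over `k` has
finite mean, and its terms tend to zero almost surely. -/
theorem ae_tendsto_sawSum {w : W → Ω → ℝ≥0∞} (hw : ∀ e, Measurable (w e)) (hind : iIndepFun w P)
    {q : ℝ≥0∞} (hq : ∀ e, ∫⁻ ω, w e ω ∂P ≤ q) {a : ℝ} (haq : ENNReal.ofReal (Real.exp a) * q < 1)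
    (x : W) {N : ℕ → ℕ} (hN : StrictMono N)
    (hcard : ∀ k, ((saws hG x (N k)).card : ℝ) ≤ Real.exp (a * (N k + 1))) :
    ∀ᵐ ω ∂P, Filter.Tendsto (fun k => sawSum hG (fun e => w e ω) x (N k)) Filter.atTop (nhds 0) := by
  set r := ENNReal.ofReal (Real.exp a) * q
  have hle : ∀ k, ∫⁻ ω, sawSum hG (fun e => w e ω) x (N k) ∂P ≤ r ^ k := by
    intro k
    calc ∫⁻ ω, sawSum hG (fun e => w e ω) x (N k) ∂P
        ≤ (saws hG x (N k)).card * q ^ (N k + 1) := lintegral_sawSum_le hG hw hind hq x (N k)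
      _ ≤ ENNReal.ofReal (Real.exp a) ^ (N k + 1) * q ^ (N k + 1) := by
          gcongr
          rw [← ENNReal.ofReal_pow (Real.exp_pos a).le, ← Real.exp_nat_mul,
            ← ENNReal.ofReal_natCast]
          refine ENNReal.ofReal_le_ofReal ((hcard k).trans_eq ?_)
          push_cast
          rw [mul_comm]
      _ = r ^ (N k + 1) := (mul_pow _ _ _).symm
      _ ≤ r ^ k := pow_le_pow_right_of_le_one' haq.le (hN.le_apply.trans (Nat.le_succ _))
  have hmeas := fun k => measurable_sawSum hG hw x (N k)
  have hfin : ∫⁻ ω, ∑' k, sawSum hG (fun e => w e ω) x (N k) ∂P ≠ ∞ := by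
    rw [lintegral_tsum fun k => (hmeas k).aemeasurable]
    refine ne_top_of_le_ne_top ?_ (ENNReal.tsum_le_tsum hle)
    rw [ENNReal.tsum_geometric]
    exact ENNReal.inv_ne_top.2 (tsub_pos_of_lt haq).ne'
  filter_upwards [ae_lt_top (Measurable.tsum hmeas) hfin] with ω hω
  exact ENNReal.tendsto_atTop_zero_of_tsum_ne_top hω.ne

end Random

/-- Only finitely many hyperedges meet `I`, so one `k` makes all their path sums small. The set `D`
then collects `I` and every hyperedge within reach of paths with at most `N e k` steps. -/
theorem HasBounds.hasSmallInfluence {V S : Type*} [MeasurableSpace S] {H : DependenceHypergraph V}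
    {h : ∀ e : H.edges, (↥e.1 → S) → ℝ} {m M : H.edges → ℝ} (hh : HasBounds h m M)
    (χ : Measure S) [IsProbabilityMeasure χ] {p : H.edges → ℝ}
    (hp : ∀ e s s', h e s * h e s' ≤ m e ^ 2 + p e * (h e s * h e s'))
    {N : H.edges → ℕ → ℕ}
    (hN : ∀ e, Filter.Tendsto (fun k => sawSum H.finite_neighborSet_lineGraph
      (fun e => ENNReal.ofReal (p e)) e (N e k)) Filter.atTop (nhds 0)) :
    HasSmallInfluence H χ h := by
  classical
  intro I ε hε
  have hlim : Filter.Tendsto (fun k => ∑ e ∈ (H.finite_edgesMeeting I).toFinset,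
      sawSum H.finite_neighborSet_lineGraph (fun e => ENNReal.ofReal (p e)) e (N e k))
      Filter.atTop (nhds 0) := by
    simpa using tendsto_finsetSum (H.finite_edgesMeeting I).toFinset fun e _ => hN e
  obtain ⟨k, hk⟩ := ((ENNReal.tendsto_nhds_zero.1 hlim) ε hε.bot_lt).exists
  refine ⟨I ∪ (H.finite_edgesMeeting I).toFinset.biUnion fun e =>
    (Finset.range (N e k + 1)).biUnion fun n =>
      (saws H.finite_neighborSet_lineGraph e n).biUnion fun q => q.1, Finset.subset_union_left,
    fun Λ σ σ' hσ A hA => ?_⟩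
  refine (hh.spec_apply_le χ hp I _ (fun e => N e k)
    (Finset.coe_subset.2 Finset.subset_union_left) ?_ Λ (fun x hx => hσ x (Finset.mem_coe.1 hx))
    hA).trans (by gcongr)
  intro e he n hn q hq x hx
  refine Finset.mem_coe.2 (Finset.mem_union_right _ ?_)
  exact Finset.mem_biUnion.2 ⟨e, (Set.Finite.mem_toFinset _).2 he, Finset.mem_biUnion.2
    ⟨n, Finset.mem_range.2 (Nat.lt_succ_of_le hn), Finset.mem_biUnion.2 ⟨q, hq, hx⟩⟩⟩

theorem degAverage_le_of_isTempered {W : Type*} {G : SimpleGraph W} {g : ℕ → ℝ} {a : ℝ}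
    (ha : 0 ≤ a) (hT : IsTempered G g a) :
    ∃ N : W → ℕ → ℕ, (∀ x, StrictMono (N x)) ∧ (∀ x k, 0 < N x k) ∧
      ∀ x k, ∀ A ∈ animals G (N x k) x, degAverage G g A ≤ a := by
  obtain ⟨N, h1, h2, h3⟩ := hT
  refine ⟨N, h1, h2, fun x k A hA => (ENNReal.ofReal_le_ofReal_iff ha).1 ?_⟩
  rw [← h3]
  exact le_iSup_of_le x (le_iSup_of_le k (le_iSup₂_of_le A hA le_rfl))

theorem DependenceHypergraph.infinite_vertices {V : Type*} (H : DependenceHypergraph V) :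
    Infinite V := by
  by_contra hV
  rw [not_infinite_iff_finite] at hV
  exact H.infinite (Set.toFinite _)

/-- The bounds on the interactions, in the form used for disagreement percolation. -/
theorem exp_mul_exp_le {K lo c x y : ℝ} (hK : 0 < K) (hx : x ≤ lo + c) (hy : y ≤ lo + c) :
    Real.exp (K * x) * Real.exp (K * y) ≤ Real.exp (K * lo) ^ 2 +
      (1 - Real.exp (-(2 * K * c))) * (Real.exp (K * x) * Real.exp (K * y)) := by
  -- Each factor is at most `exp (K c)` times its lower bound `exp (K lo)`.
  have h : Real.exp (-(2 * K * c)) * (Real.exp (K * x) * Real.exp (K * y)) ≤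
      Real.exp (K * lo) ^ 2 := by
    rw [← Real.exp_add, ← Real.exp_add, ← Real.exp_nat_mul]
    refine Real.exp_le_exp.2 ?_
    push_cast
    nlinarith
  linarith

end MarkovField

/-! ### The main theorem -/

theorem theorem2 {V S Ω : Type*} [Countable V]
    [MeasurableSpace S] [StandardBorelSpace S] (χ : Measure S) [IsProbabilityMeasure χ]
    -- the hypergraph, whose line-graph is `(g, a)`-tempered with `g n ≥ log n`
    (H : MarkovField.DependenceHypergraph V)
    (g : ℕ → ℝ) (hg : StrictMonoOn g (Set.Ici 1)) (hlog : ∀ n : ℕ, 1 ≤ n → Real.log n ≤ g n)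
    (a : ℝ) (ha : 0 < a) (hT : MarkovField.IsTempered H.lineGraph g a)
    -- the random interactions, with random bounds `lo e ≤ φ e ≤ hi e` and `c e = hi e - lo e`
    [MeasurableSpace Ω] (P : Measure Ω) [IsProbabilityMeasure P]
    (φ : ∀ e : H.edges, Ω → (↥e.1 → S) → ℝ)
    (hφ : ∀ e ω, Measurable (φ e ω))
    (lo hi c : H.edges → Ω → ℝ)
    (hbd : ∀ e ω s, lo e ω ≤ φ e ω s ∧ φ e ω s ≤ hi e ω)
    (hc : ∀ e ω, c e ω = hi e ω - lo e ω)
    (hindep : iIndepFun c P)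
    (hident : ∀ e e', IdentDistrib (c e) (c e') P P)
    (hmom : ∀ K : ℝ, 0 < K → ∀ e, Integrable (fun ω => Real.exp (K * c e ω)) P) :
    ∃ Kstar : ℝ, 0 < Kstar ∧ ∀ K : ℝ, 0 < K → K < Kstar →
      ∀ᵐ ω ∂P, ∃ μ : Measure (V → S),
        MarkovField.fields H χ (fun e s => Real.exp (K * φ e ω s)) = {μ} ∧
        MarkovField.IsGloballyMarkov H μ := by
  have hV := H.infinite_vertices
  have hHcount : Countable H.edges := inferInstance
  obtain ⟨e₀⟩ : Nonempty H.edges := H.infinite.nonempty.to_subtype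
  obtain ⟨N, hN, hNpos, hanimal⟩ := MarkovField.degAverage_le_of_isTempered ha.le hT
  set E := ∫ ω, Real.exp (1 * c e₀ ω) ∂P
  have hE : 0 ≤ E := integral_nonneg fun ω => (Real.exp_pos _).le
  have hEe : ∀ e, ∫ ω, Real.exp (1 * c e ω) ∂P = E := fun e =>
    ((hident e e₀).comp (u := fun t => Real.exp (1 * t)) (by fun_prop)).integral_eq
  -- From `1 - exp (-2 K c) ≤ 2 K c ≤ 2 K exp c`, the mean of `p e` is at most `2 K E`. Below this
  -- threshold its product with `exp a` is less than 1; `E + 1` makes positivity immediate from `0 ≤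
  -- E`.
  refine ⟨(4 * (E + 1) * Real.exp a)⁻¹, by positivity, fun K hK hK' => ?_⟩
  have hcm : ∀ e, AEMeasurable (c e) P := fun e => (hident e e).aemeasurable_fst
  -- The `c e` are only almost everywhere measurable. Measurable versions replace them, equal
  -- simultaneously almost surely as there are countably many hyperedges.
  let c' : H.edges → Ω → ℝ := fun e => (hcm e).mk (c e)
  have hcc' : ∀ e, c e =ᵐ[P] c' e := fun e => (hcm e).ae_eq_mk
  let v : ℝ → ℝ≥0∞ := fun t => ENNReal.ofReal (1 - Real.exp (-(2 * K * t)))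
  have hv : Measurable v := by fun_prop
  have hvle : ∀ t, v t ≤ ENNReal.ofReal (2 * K * Real.exp (1 * t)) := fun t => by
    refine ENNReal.ofReal_le_ofReal ?_
    have h1 := Real.add_one_le_exp (-(2 * K * t))
    have h2 := Real.add_one_le_exp (1 * t)
    nlinarith
  let w : H.edges → Ω → ℝ≥0∞ := fun e ω => v (c' e ω)
  have hw : ∀ e, Measurable (w e) := fun e => hv.comp (hcm e).measurable_mk
  have hwind : iIndepFun w P := (hindep.congr hcc').comp (fun _ => v) fun _ => hv
  have hq : ∀ e, ∫⁻ ω, w e ω ∂P ≤ ENNReal.ofReal (2 * K * E) := by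
    intro e
    calc ∫⁻ ω, w e ω ∂P ≤ ∫⁻ ω, ENNReal.ofReal (2 * K * Real.exp (1 * c e ω)) ∂P := by
          refine lintegral_mono_ae ?_
          filter_upwards [hcc' e] with ω hω
          rw [hω]
          exact hvle _
      _ = ENNReal.ofReal (2 * K * E) := by
          rw [← ofReal_integral_eq_lintegral_ofReal ((hmom 1 one_pos e).const_mul _)
            (Filter.Eventually.of_forall fun ω => by positivity), integral_const_mul, hEe]
  have haq : ENNReal.ofReal (Real.exp a) * ENNReal.ofReal (2 * K * E) < 1 := by
    rw [← ENNReal.ofReal_mul (Real.exp_pos a).le, ENNReal.ofReal_lt_one]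
    have hpos : 0 < 4 * (E + 1) * Real.exp a := by positivity
    have h1 : K * (4 * (E + 1) * Real.exp a) < 1 := by
      have := mul_lt_mul_of_pos_right hK' hpos
      rwa [inv_mul_cancel₀ hpos.ne'] at this
    have h2 : 0 ≤ Real.exp a * (K * E) := by positivity
    have h3 : 0 ≤ Real.exp a * K := by positivity
    nlinarith
  have hlim : ∀ᵐ ω ∂P, ∀ e, Filter.Tendsto (fun k => MarkovField.sawSum
      H.finite_neighborSet_lineGraph (fun e => w e ω) e (N e k)) Filter.atTop (nhds 0) :=
    ae_all_iff.2 fun e => MarkovField.ae_tendsto_sawSum _ hw hwind hq haq e (hN e) fun k =>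
      MarkovField.card_saws_le _ (hNpos e k).ne' hlog (hanimal e k)
  filter_upwards [hlim, ae_all_iff.2 hcc'] with ω hω hcω
  have hh : MarkovField.HasBounds (fun e s => Real.exp (K * φ e ω s))
      (fun e => Real.exp (K * lo e ω)) (fun e => Real.exp (K * hi e ω)) :=
    { measurable := fun e => ((hφ e ω).const_mul K).exp
      pos := fun e => Real.exp_pos _
      lower := fun e s => Real.exp_le_exp.2 (mul_le_mul_of_nonneg_left (hbd e ω s).1 hK.le)
      upper := fun e s => Real.exp_le_exp.2 (mul_le_mul_of_nonneg_left (hbd e ω s).2 hK.le) }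
  have hsmall : MarkovField.HasSmallInfluence H χ fun e s => Real.exp (K * φ e ω s) := by
    refine hh.hasSmallInfluence χ (p := fun e => 1 - Real.exp (-(2 * K * c' e ω)))
      (fun e s s' => ?_) hω
    rw [← hcω e]
    have hle : ∀ s, φ e ω s ≤ lo e ω + c e ω := fun s => by
      rw [hc]
      linarith [(hbd e ω s).2]
    exact MarkovField.exp_mul_exp_le hK (hle s) (hle s')
  obtain ⟨μ, hμ⟩ := MarkovField.exists_mem_fields hh hsmall
  refine ⟨μ, Set.eq_singleton_iff_unique_mem.2 ⟨hμ, fun ν hν => ?_⟩, ?_⟩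
  · exact MarkovField.eq_of_mem_fields hh hsmall hν hμ
  · exact MarkovField.isGloballyMarkov_of_mem_fields hh hsmall hμ
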